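/- All varieties are over $\mathbb{C}$ and surfaces are irreducible. Let $V, W$ be smooth projective surfaces, and let $D$ and $\Delta$ be reduced effective divisors (possibly zero) with simple normal crossings on $V$ and $W$, respectively. Let $\Phi : W \to V$ be a dominant morphism such that $\Phi^{-1}(D) \subseteq \Delta$ (as sets) and such that every irreducible component of $\Delta$ not contained in $\Phi^{-1}(D)$ is contracted by $\Phi$ (mapped to a point). Let $\omega \neq 0$ be a rational $2$-form on $V$, put $K_V = \operatorname{div}(\omega)$ and $K_W = \operatorname{div}(\Phi^*\omega)$, and let $R$ be the logarithmic ramification divisor, i.e. the divisor on $W$ defined by $$\Delta + K_W = \Phi^*(D + K_V) + R .$$ We say that $\Phi$ ramifies along an irreducible curve $C \subset W$ if $\Phi(C)$ is a curve and the ramification index of $\Phi$ along $C$ is at least $2$, i.e. the pullback under $\Phi$ of a local equation of $\Phi(C)$ at its generic point vanishes to order at least $2$ along $C$. Then: 1. Every irreducible curve $C$ on $W$ with nonzero coefficient in $R$ is contracted by $\Phi$, or $\Phi$ ramifies along $C$. 2. Every irreducible component of $\Delta$ that is not contracted by $\Phi$ has coefficient zero in $R$. 3. If an irreducible component $C$ of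 $\Delta$ has coefficient zero in $R$ and is contracted by $\Phi$, then the point $\Phi(C)$ is an intersection point of two distinct irreducible components of $D$. -/

import Mathlib

open AlgebraicGeometry CategoryTheory
open scoped KaehlerDifferential

noncomputable section

namespace LogRamification

/-! ### Smooth projective complex surfaces -/

attribute [local instance] MvPolynomial.gradedAlgebra

/-- The complex projective space of dimension `n`, as `Proj ℂ[X₀, …, Xₙ]`. -/
abbrev projectiveSpace (n : ℕ) : Scheme.{0} :=
  Proj (MvPolynomial.homogeneousSubmodule (Fin (n + 1)) ℂ)

/-- The structure morphism of projective space over `Spec ℂ`. -/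
def projectiveSpaceToSpec (n : ℕ) : projectiveSpace n ⟶ Spec (.of ℂ) :=
  Proj.toSpecZero _ ≫ Spec.map (CommRingCat.ofHom
    (algebraMap ℂ (MvPolynomial.homogeneousSubmodule (Fin (n + 1)) ℂ 0)))

/-- A smooth projective (irreducible) surface over the field of complex numbers. -/
structure SmoothProjectiveSurface where
  /-- the underlying scheme -/
  scheme : Scheme.{0}
  /-- the structure morphism -/
  str : scheme ⟶ Spec (.of ℂ)
  isIntegral : IsIntegral scheme
  smooth : SmoothOfRelativeDimension 2 str
  projective : ∃ (n : ℕ) (i : scheme ⟶ projectiveSpace n),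
    IsClosedImmersion i ∧ i ≫ projectiveSpaceToSpec n = str

namespace SmoothProjectiveSurface

variable (X : SmoothProjectiveSurface)

instance : IsIntegral X.scheme := X.isIntegral

instance : SmoothOfRelativeDimension 2 X.str := X.smooth

instance : IsLocallyNoetherian X.scheme := by
  have : Smooth X.str := SmoothOfRelativeDimension.smooth 2 X.str
  have : IsNoetherianRing (CommRingCat.of ℂ) := inferInstanceAs (IsNoetherianRing ℂ)
  exact LocallyOfFiniteType.isLocallyNoetherian X.str

/-- The local ring `𝒪_{X,x}`. -/
abbrev localRing (x : X.scheme) : CommRingCat.{0} := X.scheme.presheaf.stalk x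

/-- The field `ℂ(X)` of rational functions, i.e. the local ring at the generic point. -/
abbrev rationalFunctions : CommRingCat.{0} := X.scheme.functionField

/-- The local rings of `X` (in particular its function field) are `ℂ`-algebras through the
structure morphism. -/
instance (x : X.scheme) : Algebra ℂ (X.localRing x) :=
  ((Scheme.ΓSpecIso (.of ℂ)).inv ≫ X.str.appTop ≫
    X.scheme.presheaf.germ ⊤ x (TopologicalSpace.Opens.mem_top x)).hom.toAlgebra

/-- Rational differential `2`-forms on `X`. -/
abbrev RationalTwoForm : Type := ⋀[X.rationalFunctions]^2 (Ω[X.rationalFunctions⁄ℂ])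

/-- The `2`-form `ds ∧ dt`. -/
def wedge (s t : X.rationalFunctions) : X.RationalTwoForm :=
  exteriorPower.ιMulti X.rationalFunctions 2
    ![KaehlerDifferential.D ℂ X.rationalFunctions s, KaehlerDifferential.D ℂ X.rationalFunctions t]

end SmoothProjectiveSurface

/-! ### Prime divisors, reduced divisors, simple normal crossings -/

/-- An irreducible curve on `X`, given by its generic point, a point of codimension one. -/
@[ext]
structure PrimeDivisor (X : SmoothProjectiveSurface) where
  /-- the generic point of the curve -/
  point : X.scheme
  coheight_point : Order.coheight point = 1

namespace PrimeDivisor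

variable {X : SmoothProjectiveSurface} (C : PrimeDivisor X)

/-- The set of points of the curve. -/
def curve : Set X.scheme := closure {C.point}

open scoped Classical in
/-- The stalk at `x` of the ideal sheaf of the curve: the prime ideal of the functions that vanish
at the generic point of the curve if `x` lies on the curve, the unit ideal otherwise. -/
def idealAt (x : X.scheme) : Ideal (X.localRing x) :=
  if h : C.point ⤳ x then
    (IsLocalRing.maximalIdeal (X.localRing C.point)).comap
      (X.scheme.presheaf.stalkSpecializes h).hom
  else ⊤

end PrimeDivisor

/-- A reduced effective divisor, as the finite set of its irreducible components. -/
abbrev ReducedDivisor (X : SmoothProjectiveSurface) : Type := Finset (PrimeDivisor X)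

namespace ReducedDivisor

variable {X : SmoothProjectiveSurface} (D : ReducedDivisor X)

/-- The support of a reduced divisor. -/
def support : Set X.scheme := ⋃ C ∈ D, C.curve

/-- Simple normal crossings: at every closed point there is a regular system of parameters `t, u`
such that each component of `D` through the point is cut out by `t` or by `u`. -/
def IsSNC : Prop :=
  ∀ x : X.scheme, IsClosed {x} → ∃ t u : X.localRing x,
    Ideal.span {t, u} = IsLocalRing.maximalIdeal (X.localRing x) ∧
    ∀ C ∈ D, x ∈ C.curve → C.idealAt x = Ideal.span {t} ∨ C.idealAt x = Ideal.span {u}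

end ReducedDivisor

/-! ### Divisors through local equations -/

/-- A divisor given by its local equations: to each point `x` of `X` the set of the rational
functions that are a local equation of the divisor at `x`. -/
abbrev LocalEquations (X : SmoothProjectiveSurface) : Type :=
  X.scheme → Set X.rationalFunctions

namespace LocalEquations

variable {X : SmoothProjectiveSurface}

/-- The sum of two divisors: local equations are multiplied. -/
def add (E F : LocalEquations X) : LocalEquations X :=
  fun x => {g | ∃ e ∈ E x, ∃ f ∈ F x, g = e * f}

/-- The local equations of a reduced divisor `D = ∑ Cᵢ`: generators of the stalk of the ideal sheaf
`𝒪(-D) = ∏ 𝒪(-Cᵢ)`. -/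
def ofReduced (D : ReducedDivisor X) : LocalEquations X :=
  fun x => {g | ∃ h : X.localRing x, Ideal.span {h} = ∏ C ∈ D, C.idealAt x ∧
    g = algebraMap (X.localRing x) X.rationalFunctions h}

/-- The local equations of the canonical divisor `K_X = div ω`: the functions `a` with
`ω = a • ds ∧ dt` for local coordinates `s, t` at the point, i.e. functions whose differentials
form a basis of the module of differentials of the local ring. -/
def canonical (ω : X.RationalTwoForm) : LocalEquations X :=
  fun x => {a | ∃ s t : X.localRing x,
    LinearIndependent (X.localRing x)
      ![KaehlerDifferential.D ℂ (X.localRing x) s, KaehlerDifferential.D ℂ (X.localRing x) t] ∧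
    Submodule.span (X.localRing x)
      {KaehlerDifferential.D ℂ (X.localRing x) s, KaehlerDifferential.D ℂ (X.localRing x) t} = ⊤ ∧
    ω = a • X.wedge (algebraMap (X.localRing x) X.rationalFunctions s)
      (algebraMap (X.localRing x) X.rationalFunctions t)}

open scoped Classical in
/-- The coefficients of the divisor: the coefficient of the curve `C` is the order along `C` of a
local equation at the generic point of `C`. -/
def coeff (E : LocalEquations X) (C : PrimeDivisor X) : ℤ :=
  if h : (E C.point).Nonempty then Scheme.ord (X := X.scheme) h.some C.point else 0

end LocalEquations

/-! ### Dominant morphisms -/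

/-- A dominant morphism of surfaces over `ℂ`. -/
structure DominantMorphism (W V : SmoothProjectiveSurface) where
  /-- the underlying morphism of schemes -/
  hom : W.scheme ⟶ V.scheme
  comp_str : hom ≫ V.str = W.str
  isDominant : IsDominant hom

/-- The map `⋀² Ω_{A/k} → ⋀² Ω_{B/k}`, `a • ds ∧ dt ↦ φ(a) • dφ(s) ∧ dφ(t)`, induced by a
homomorphism `φ : A → B` of `k`-algebras. -/
def twoFormMap (k A B : Type) [CommRing k] [CommRing A] [CommRing B] [Algebra k A] [Algebra k B]
    [Algebra A B] [IsScalarTower k A B] : ⋀[A]^2 (Ω[A⁄k]) →ₗ[A] ⋀[B]^2 (Ω[B⁄k]) :=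
  exteriorPower.alternatingMapLinearEquiv
    { ((exteriorPower.ιMulti B 2 (M := Ω[B⁄k])).toMultilinearMap.restrictScalars
        A).compLinearMap (fun _ => KaehlerDifferential.map k k A B) with
      map_eq_zero_of_eq' := fun v i j h hij =>
        (exteriorPower.ιMulti B 2 (M := Ω[B⁄k])).map_eq_zero_of_eq
          (fun i => KaehlerDifferential.map k k A B (v i)) (by simp only [h]) hij }

namespace DominantMorphism

variable {W V : SmoothProjectiveSurface} (Φ : DominantMorphism W V)

theorem map_genericPoint : Φ.hom (genericPoint W.scheme) = genericPoint V.scheme := by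
  have h := (genericPoint_spec W.scheme).image Φ.hom.continuous
  have := Φ.isDominant
  rw [Set.image_univ, Φ.hom.denseRange.closure_range] at h
  exact h.eq (genericPoint_spec V.scheme)

/-- The map `Φ^* : ℂ(V) → ℂ(W)` on rational functions, as a ring homomorphism. -/
def pullbackRingHom : V.rationalFunctions →+* W.rationalFunctions :=
  (V.scheme.presheaf.stalkSpecializes (specializes_of_eq Φ.map_genericPoint) ≫
    Φ.hom.stalkMap (genericPoint W.scheme)).hom

theorem pullbackRingHom_algebraMap (c : ℂ) :
    Φ.pullbackRingHom (algebraMap ℂ V.rationalFunctions c) =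
      algebraMap ℂ W.rationalFunctions c := by
  have h : (Scheme.ΓSpecIso (.of ℂ)).inv ≫ V.str.appTop ≫
      V.scheme.presheaf.germ ⊤ (genericPoint V.scheme)
        (TopologicalSpace.Opens.mem_top _) ≫
      V.scheme.presheaf.stalkSpecializes (specializes_of_eq Φ.map_genericPoint) ≫
      Φ.hom.stalkMap (genericPoint W.scheme) =
      (Scheme.ΓSpecIso (.of ℂ)).inv ≫ W.str.appTop ≫
      W.scheme.presheaf.germ ⊤ (genericPoint W.scheme)
        (TopologicalSpace.Opens.mem_top _) := by
    rw [← Φ.comp_str, Scheme.Hom.comp_appTop, TopCat.Presheaf.germ_stalkSpecializes_assoc,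
      Scheme.Hom.germ_stalkMap]
    rfl
  exact congr($(h).hom c)

/-- The map `Φ^* : ℂ(V) → ℂ(W)` on rational functions. -/
def pullbackFunction : V.rationalFunctions →ₐ[ℂ] W.rationalFunctions :=
  { Φ.pullbackRingHom with commutes' := Φ.pullbackRingHom_algebraMap }

/-- The pullback of rational `2`-forms. -/
def pullbackForm : V.RationalTwoForm → W.RationalTwoForm :=
  letI : Algebra V.rationalFunctions W.rationalFunctions := Φ.pullbackFunction.toRingHom.toAlgebra
  haveI : IsScalarTower ℂ V.rationalFunctions W.rationalFunctions :=
    IsScalarTower.of_algHom Φ.pullbackFunction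
  twoFormMap ℂ V.rationalFunctions W.rationalFunctions

/-- The pullback of divisors: local equations are pulled back. -/
def pullbackDivisor (E : LocalEquations V) : LocalEquations W :=
  fun x => Φ.pullbackFunction '' E (Φ.hom x)

/-- `Φ` contracts the curve `C`, i.e. `Φ(C)` is a point. -/
def Contracts (C : PrimeDivisor W) : Prop :=
  ∃ Q : V.scheme, Φ.hom '' C.curve = {Q}

/-- `Φ` ramifies along the curve `C`: the image of `C` is a curve, and the ramification index of
`𝒪_{V,Φ(C)} → 𝒪_{W,C}` is at least two, i.e. a local equation of the curve `Φ(C)` vanishes to order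
at least two along `C`. -/
def RamifiesAlong (C : PrimeDivisor W) : Prop :=
  Order.coheight (Φ.hom C.point) = 1 ∧
    (IsLocalRing.maximalIdeal (V.localRing (Φ.hom C.point))).map (Φ.hom.stalkMap C.point).hom ≤
      IsLocalRing.maximalIdeal (W.localRing C.point) ^ 2

/-- `R` is the logarithmic ramification divisor of `Φ : (W, Δ) → (V, D)`:
`Δ + K_W = Φ^*(D + K_V) + R` with `K_V = div ω` and `K_W = div Φ^*ω`. -/
def IsLogRamificationDivisor (D : ReducedDivisor V) (Δ : ReducedDivisor W)
    (ω : V.RationalTwoForm) (R : PrimeDivisor W → ℤ) : Prop :=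
  ∀ C : PrimeDivisor W,
    ((LocalEquations.ofReduced Δ).add (LocalEquations.canonical (Φ.pullbackForm ω))).coeff C =
      (Φ.pullbackDivisor
        ((LocalEquations.ofReduced D).add (LocalEquations.canonical ω))).coeff C + R C

end DominantMorphism

end LogRamification

end

/-! The statement is a computation at the generic point of each curve `C` on `W`. Let `s, t` be
local coordinates on `V` at the image of that point and `σ, τ` local coordinates on `W`, with `τ` a
uniformizer along `C`, and write `ds ∧ dt = J dσ ∧ dτ` after pullback. If `ω = a ds ∧ dt`, then
`Φ^*ω = Φ^*(a) J dσ ∧ dτ`, so the order of `Φ^*(a)` cancels. What remains is `ord g + ord J = ord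
Φ^*(f) + R C`, with `g` and `f` local equations of `Δ` and `D` (`logRamification_eq`).

If `C` is not contracted, its image is a curve with a uniformizer `t`, and `t` pulls back to a unit
times `τ ^ (n + 1)`. A function `s` that is not constant on the image remains nonconstant on `C`, so
`σ = Φ^*s` is allowed, and in characteristic zero `J` has order exactly `n`. The hypotheses on `Δ`
say that `C` lies in `Δ` iff its image lies in `D`. Hence `R C` is `0` inside `Δ` and `n` outside,
where `n ≠ 0` means ramification (`exists_coefficient_eq`).

If `C` is a contracted component of `Δ`, take parameters `t, u` at the image point. Both vanish
along `C`, so `ord J ≥ ord Φ^*(t)`. If at most one component of `D` passes through the point, `f`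
may be taken to be `1` or `t`, and then `R C ≥ 1` (`coefficient_pos_of_isClosed`). Only at a
crossing, where `f = t * u`, does this bound fail.

The geometry of points is read off from differentials of residue fields: the exact sequence `0 →
𝔪/𝔪² → κ ⊗ Ω → Ω_κ → 0` with middle term of dimension two separates closed points, curves and the
generic point. -/

noncomputable section

namespace LogRamification

/-! ### Local coordinates on two-dimensional smooth local algebras -/

section LocalAlgebra

set_option linter.unusedSectionVars false

open IsLocalRing TensorProduct KaehlerDifferential

/-- The algebra `A` is formally smooth and essentially of finite type over `k`, with module of
differentials of rank two. -/
class IsSmoothSurfaceAlgebra (k A : Type*) [CommRing k] [CommRing A] [Algebra k A] : Prop extends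
    Algebra.FormallySmooth k A, Algebra.EssFiniteType k A where
  finrank_kaehler : Module.finrank A Ω[A⁄k] = 2

/-- The differentials of `s` and `t` form a basis of the module of differentials. -/
def IsCoordinates (k : Type*) {A : Type*} [CommRing k] [CommRing A] [Algebra k A] (s t : A) :
    Prop :=
  LinearIndependent A ![D k A s, D k A t] ∧ Submodule.span A {D k A s, D k A t} = ⊤

/-! ### Differentials of field extensions in characteristic zero. -/

section Field

variable {k K L : Type*} [Field k] [Field K] [Field L] [CharZero k] [Algebra k K] [Algebra k L]
  [Algebra K L] [IsScalarTower k K L]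

/-- In characteristic zero `L` is formally smooth over `K`, so the first cotangent homology, which
surjects onto the kernel, vanishes. -/
theorem mapBaseChange_injective_of_field [Algebra.EssFiniteType k L] :
    Function.Injective (mapBaseChange k K L) := by
  have : CharZero K := charZero_of_injective_algebraMap (algebraMap k K).injective
  have : Algebra.EssFiniteType K L := .of_comp k K L
  have : Algebra.FormallySmooth K L := inferInstance
  have := this.subsingleton_h1Cotangent
  rw [injective_iff_map_eq_zero]
  intro x hx
  obtain ⟨y, rfl⟩ := (Algebra.H1Cotangent.exact_δ_mapBaseChange k K L x).mp hx
  rw [Subsingleton.elim y 0, map_zero]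

theorem linearIndependent_map_of_field [Algebra.EssFiniteType k L] {ι : Type*} {v : ι → Ω[K⁄k]}
    (hv : LinearIndependent K v) : LinearIndependent L (fun i => map k k K L (v i)) := by
  have h := (Module.Flat.linearIndependent_one_tmul (S := L) hv).map' (mapBaseChange k K L)
    (LinearMap.ker_eq_bot.mpr mapBaseChange_injective_of_field)
  have he : (fun i => map k k K L (v i)) = mapBaseChange k K L ∘ fun i => 1 ⊗ₜ v i := by
    ext i
    simp
  rw [he]
  exact h

end Field

/-! ### The conormal sequence of the residue field, and criteria for coordinates. -/

section Cotangent

variable {k A : Type*} [Field k] [CharZero k] [CommRing A] [IsLocalRing A] [Algebra k A]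
  [IsSmoothSurfaceAlgebra k A]

variable (k A) in
/-- The map `𝔪/𝔪² → κ ⊗ Ω`, `x ↦ 1 ⊗ dx`. -/
def cotangentToTensor : CotangentSpace A →ₗ[ResidueField A] ResidueField A ⊗[A] Ω[A⁄k] :=
  LinearMap.extendScalarsOfSurjective (R := A) (S := ResidueField A) residue_surjective
    (kerCotangentToTensor k A (ResidueField A) ∘ₗ
      (Ideal.Cotangent.equivOfEq _ _ ker_residue.symm).toLinearMap)

theorem cotangentToTensor_toCotangent (x : maximalIdeal A) :
    cotangentToTensor k A ((maximalIdeal A).toCotangent x) = 1 ⊗ₜ D k A x.1 := rfl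

variable (k A) in
-- The residue field is formally smooth over `k` because the characteristic is zero, so the conormal
-- sequence is exact on the left.
theorem cotangentToTensor_injective : Function.Injective (cotangentToTensor k A) := by
  have : Algebra.EssFiniteType k (ResidueField A) :=
    inferInstanceAs (Algebra.EssFiniteType k (A ⧸ maximalIdeal A))
  have hs : Function.Surjective (algebraMap A (ResidueField A)) := residue_surjective
  have h := (Algebra.FormallySmooth.kerCotangentToTensor_injective_iff (R := k) hs).mpr
    (Algebra.FormallySmooth.subsingleton_h1Cotangent)
  exact h.comp (LinearEquiv.injective _)

variable (k A) in
theorem exact_cotangentToTensor :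
    Function.Exact (cotangentToTensor k A) (mapBaseChange k A (ResidueField A)) := by
  have hs : Function.Surjective (algebraMap A (ResidueField A)) := residue_surjective
  have h := exact_kerCotangentToTensor_mapBaseChange k A (ResidueField A) hs
  intro y
  rw [h y]
  constructor
  · rintro ⟨x, rfl⟩
    obtain ⟨z, rfl⟩ := (Ideal.Cotangent.equivOfEq _ _ ker_residue.symm).surjective x
    exact ⟨z, rfl⟩
  · rintro ⟨x, rfl⟩
    exact ⟨_, rfl⟩

variable (k A) in
theorem free_kaehler : Module.Free A Ω[A⁄k] :=
  Module.free_of_flat_of_isLocalRing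

variable (k A) in
theorem finrank_tensor_kaehler :
    Module.finrank (ResidueField A) (ResidueField A ⊗[A] Ω[A⁄k]) = 2 := by
  have := free_kaehler k A
  rw [Module.finrank_baseChange, IsSmoothSurfaceAlgebra.finrank_kaehler]

theorem isCoordinates_of_span {s t : A} (h : Submodule.span A {D k A s, D k A t} = ⊤) :
    IsCoordinates k s t := by
  refine ⟨linearIndependent_of_top_le_span_of_card_eq_finrank ?_ ?_, h⟩
  · simp [Set.pair_comm (D k A t), h]
  · simp [IsSmoothSurfaceAlgebra.finrank_kaehler]

/-- Two independent vectors form a basis of the two-dimensional fibre; by Nakayama their lifts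
generate. -/
theorem isCoordinates_of_linearIndependent {s t : A}
    (h : LinearIndependent (ResidueField A)
      ![(1 ⊗ₜ D k A s : ResidueField A ⊗[A] Ω[A⁄k]), 1 ⊗ₜ D k A t]) : IsCoordinates k s t := by
  apply isCoordinates_of_span
  have hc : Fintype.card (Fin 2) =
      Module.finrank (ResidueField A) (ResidueField A ⊗[A] Ω[A⁄k]) := by
    rw [finrank_tensor_kaehler]; rfl
  have := span_eq_top_of_tmul_eq_basis ![D k A s, D k A t]
    (basisOfLinearIndependentOfCardEqFinrank h hc) (by
      intro i
      rw [coe_basisOfLinearIndependentOfCardEqFinrank]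
      fin_cases i <;> rfl)
  simpa [Set.pair_comm (D k A t)] using this

theorem tmul_D_mul (a : A) {t : A} (ht : t ∈ maximalIdeal A) :
    (1 ⊗ₜ D k A (a * t) : ResidueField A ⊗[A] Ω[A⁄k]) = 1 ⊗ₜ (a • D k A t) := by
  have h : (1 ⊗ₜ (t • D k A a) : ResidueField A ⊗[A] Ω[A⁄k]) = 0 := by
    rw [← TensorProduct.smul_tmul, Algebra.smul_def, ResidueField.algebraMap_eq,
      (residue_eq_zero_iff t).mpr ht, zero_mul, zero_tmul]
  rw [Derivation.leibniz, tmul_add, h, add_zero]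

theorem cotangentToTensor_surjective (h : Subsingleton Ω[ResidueField A⁄k]) :
    Function.Surjective (cotangentToTensor k A) := fun y =>
  (exact_cotangentToTensor k A y).mp (Subsingleton.elim _ _)

/-- Generators of the maximal ideal are coordinates if the residue field is algebraic over `k`. -/
theorem isCoordinates_of_span_eq_maximalIdeal (h : Subsingleton Ω[ResidueField A⁄k]) {t u : A}
    (htu : Ideal.span {t, u} = maximalIdeal A) : IsCoordinates k t u := by
  apply isCoordinates_of_span
  rw [← map_tensorProduct_mk_eq_top, eq_top_iff]
  rintro y -
  obtain ⟨x, rfl⟩ := cotangentToTensor_surjective h y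
  obtain ⟨⟨x, hx⟩, rfl⟩ := Ideal.toCotangent_surjective _ x
  rw [cotangentToTensor_toCotangent]
  have ht : t ∈ maximalIdeal A := htu ▸ Ideal.subset_span (by simp)
  have hu : u ∈ maximalIdeal A := htu ▸ Ideal.subset_span (by simp)
  rw [← htu] at hx
  obtain ⟨a, b, rfl⟩ := Ideal.mem_span_pair.mp hx
  refine ⟨a • D k A t + b • D k A u, ?_, ?_⟩
  · exact add_mem (Submodule.smul_mem _ _ (Submodule.subset_span (by simp)))
      (Submodule.smul_mem _ _ (Submodule.subset_span (by simp)))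
  · simp only [mk_apply, map_add, tmul_add, tmul_D_mul _ ht, tmul_D_mul _ hu]

/-- The derivation `∂/∂t` of a coordinate system `s, t`. -/
theorem IsCoordinates.exists_derivation {s t : A} (h : IsCoordinates k s t) :
    ∃ δ : Derivation k A A, δ s = 0 ∧ δ t = 1 := by
  let b : Module.Basis (Fin 2) A Ω[A⁄k] := .mk h.1 (by simp [Set.pair_comm (D k A t), h.2])
  refine ⟨(b.coord 1).compDer (D k A), ?_, ?_⟩
  · have : D k A s = b 0 := by simp [b]
    change b.coord 1 (D k A s) = 0
    simp [this]
  · have : D k A t = b 1 := by simp [b]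
    change b.coord 1 (D k A t) = 1
    simp [this]

theorem isUnit_natCast (k A : Type*) [Field k] [CharZero k] [CommRing A] [Algebra k A] {n : ℕ}
    (hn : n ≠ 0) : IsUnit (n : A) := by
  have : IsUnit (algebraMap k A n) := IsUnit.map _ (by simpa using hn)
  simpa using this

/-- No power of `t` is divisible by `s` for coordinates `s, t` with `s` not a unit. -/
theorem IsCoordinates.not_dvd_pow {s t : A} (h : IsCoordinates k s t) (hs : ¬ IsUnit s) (n : ℕ) :
    ¬ s ∣ t ^ n := by
  obtain ⟨δ, hδs, hδt⟩ := h.exists_derivation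
  induction n with
  | zero => rwa [pow_zero, ← isUnit_iff_dvd_one]
  | succ n ih =>
    rintro ⟨c, hc⟩
    apply ih
    -- Since `δ` kills `s`, applying it to `t ^ (n + 1) = s * c` gives `(n + 1) * t ^ n = s * δ c`,
    -- and `n + 1` is invertible: the exponent drops by one.
    have := congr(δ $hc)
    rw [Derivation.leibniz_pow, Derivation.leibniz, hδs, hδt] at this
    simp only [Nat.add_sub_cancel, add_zero, smul_eq_mul, mul_one, mul_zero, nsmul_eq_mul] at this
    rw [← (isUnit_natCast k A n.succ_ne_zero).dvd_mul_left]
    exact ⟨_, this⟩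

variable (k A) in
/-- In dimension one, the residue field is transcendental over `k`. -/
theorem nontrivial_kaehler_residueField [IsDomain A] [Ring.KrullDimLE 1 A] :
    Nontrivial Ω[ResidueField A⁄k] := by
  by_contra hn
  rw [not_nontrivial_iff_subsingleton] at hn
  let v := Module.finBasisOfFinrankEq (ResidueField A) (ResidueField A ⊗[A] Ω[A⁄k])
    (finrank_tensor_kaehler k A)
  have hx : ∀ i, ∃ x : maximalIdeal A, 1 ⊗ₜ D k A x.1 = v i := by
    intro i
    obtain ⟨y, hy⟩ := cotangentToTensor_surjective hn (v i)
    obtain ⟨x, rfl⟩ := Ideal.toCotangent_surjective _ y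
    exact ⟨x, hy⟩
  choose x hx using hx
  -- If the residue field had no differentials, a basis of the fibre of `Ω` would lift to
  -- coordinates that both lie in the maximal ideal.
  have hc : IsCoordinates k (x 0).1 (x 1).1 := by
    apply isCoordinates_of_linearIndependent
    convert v.linearIndependent
    ext i
    fin_cases i <;> simp [hx]
  have h0 : (x 0).1 ≠ 0 := by
    intro h0
    have := hc.1.ne_zero 0
    simp [h0] at this
  -- In dimension at most one every prime containing the nonzero element `x 0` is maximal, so some
  -- power of `x 1` is divisible by `x 0`, against `not_dvd_pow`.
  have hrad : (x 1).1 ∈ (Ideal.span {(x 0).1}).radical := by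
    rw [Ideal.radical_eq_sInf, Ideal.mem_sInf]
    rintro p ⟨hp, hprime⟩
    have hpm := Ring.krullDimLE_one_iff_of_isPrime_bot.mp ‹_› p (by
      rintro rfl
      exact h0 (by simpa using hp)) hprime
    rw [eq_maximalIdeal hpm]
    exact (x 1).2
  obtain ⟨n, hn⟩ := hrad
  exact hc.not_dvd_pow (x 0).2 n (Ideal.mem_span_singleton.mp hn)

variable (k A) in
-- The cotangent space embeds in a plane. It is nonzero because `A` is not a field, and it is not
-- the whole plane because the cokernel is the nonzero `Ω` of the residue field. So its dimension is
-- one.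
theorem isDiscreteValuationRing_of_nontrivial [IsDomain A] [IsNoetherianRing A]
    (hA : ¬ IsField A) [hn : Nontrivial Ω[ResidueField A⁄k]] : IsDiscreteValuationRing A := by
  rw [← finrank_CotangentSpace_eq_one_iff]
  have h0 : Module.finrank (ResidueField A) (CotangentSpace A) ≠ 0 := by
    rwa [Ne, finrank_cotangentSpace_eq_zero_iff]
  have hle := LinearMap.finrank_le_finrank_of_injective (cotangentToTensor_injective k A)
  rw [finrank_tensor_kaehler] at hle
  have h2 : Module.finrank (ResidueField A) (CotangentSpace A) ≠ 2 := by
    intro h2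
    have hsurj := (LinearMap.injective_iff_surjective_of_finrank_eq_finrank
      (h2.trans (finrank_tensor_kaehler k A).symm)).mp (cotangentToTensor_injective k A)
    refine not_subsingleton _ (subsingleton_of_forall_eq (0 : Ω[ResidueField A⁄k]) fun y => ?_)
    obtain ⟨z, rfl⟩ := mapBaseChange_surjective k A (ResidueField A) residue_surjective y
    exact (exact_cotangentToTensor k A z).mpr (hsurj z)
  omega

variable (k A) in
theorem finrank_kaehler_residueField_le_one [IsNoetherianRing A] (hA : ¬ IsField A) :
    Module.finrank (ResidueField A) Ω[ResidueField A⁄k] ≤ 1 := by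
  have h0 : Module.finrank (ResidueField A) (CotangentSpace A) ≠ 0 := by
    rwa [Ne, finrank_cotangentSpace_eq_zero_iff]
  have h1 := LinearMap.finrank_range_of_inj (cotangentToTensor_injective k A)
  have h2 := LinearMap.finrank_range_add_finrank_ker (mapBaseChange k A (ResidueField A))
  rw [(exact_cotangentToTensor k A).linearMap_ker_eq, h1, finrank_tensor_kaehler,
    LinearMap.range_eq_top.mpr (mapBaseChange_surjective k A (ResidueField A) residue_surjective),
    finrank_top] at h2
  omega

variable (k A) in
theorem finrank_kaehler_residueField_of_isField [IsNoetherianRing A] (hA : IsField A) :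
    Module.finrank (ResidueField A) Ω[ResidueField A⁄k] = 2 := by
  have := subsingleton_cotangentSpace_iff.mpr hA
  have h2 := LinearMap.finrank_range_add_finrank_ker (mapBaseChange k A (ResidueField A))
  rw [(exact_cotangentToTensor k A).linearMap_ker_eq,
    LinearMap.finrank_range_of_inj (cotangentToTensor_injective k A),
    Module.finrank_zero_of_subsingleton (M := CotangentSpace A), finrank_tensor_kaehler,
    LinearMap.range_eq_top.mpr (mapBaseChange_surjective k A (ResidueField A) residue_surjective),
    finrank_top] at h2
  exact h2

theorem exists_D_residue_ne_zero [hn : Nontrivial Ω[ResidueField A⁄k]] :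
    ∃ s : A, D k (ResidueField A) (residue A s) ≠ 0 := by
  by_contra! h
  refine not_subsingleton Ω[ResidueField A⁄k] ?_
  rw [← Submodule.subsingleton_iff (ResidueField A), ← subsingleton_iff_bot_eq_top,
    ← span_range_derivation, eq_comm, Submodule.span_eq_bot]
  rintro _ ⟨x, rfl⟩
  obtain ⟨a, rfl⟩ := residue_surjective x
  exact h a

/-- A uniformizer of a curve and a function that is not constant along the curve are
coordinates. -/
theorem isCoordinates_of_D_residue_ne_zero {s t : A} (ht : t ∈ maximalIdeal A)
    (ht2 : t ∉ maximalIdeal A ^ 2) (hs : D k (ResidueField A) (residue A s) ≠ 0) :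
    IsCoordinates k s t := by
  apply isCoordinates_of_linearIndependent
  rw [LinearIndependent.pair_iff]
  intro a b hab
  have h1 : ∀ x, mapBaseChange k A (ResidueField A) (1 ⊗ₜ D k A x) =
      D k (ResidueField A) (residue A x) := by
    intro x
    simp [ResidueField.algebraMap_eq]
  have ha : a = 0 := by
    -- In the differentials of the residue field `dt` dies, which isolates `a`; the remaining
    -- coefficient is handled by injectivity on `𝔪/𝔪²`.
    have := congr(mapBaseChange k A (ResidueField A) $hab)
    rw [map_add, map_smul, map_smul, map_zero, h1, h1, (residue_eq_zero_iff t).mpr ht, map_zero,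
      smul_zero, add_zero] at this
    exact (smul_eq_zero.mp this).resolve_right hs
  refine ⟨ha, ?_⟩
  rw [ha, zero_smul, zero_add] at hab
  refine (smul_eq_zero.mp hab).resolve_right fun h => ht2 ?_
  have := cotangentToTensor_injective k A (a₁ := (maximalIdeal A).toCotangent ⟨t, ht⟩) (a₂ := 0)
    (by rw [cotangentToTensor_toCotangent, map_zero]; exact h)
  exact (Ideal.toCotangent_eq_zero _ _).mp this

theorem _root_.Irreducible.isCoordinates_of_D_residue_ne_zero [IsDomain A]
    [IsDiscreteValuationRing A] {s t : A} (ht : Irreducible t)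
    (hs : D k (ResidueField A) (residue A s) ≠ 0) : IsCoordinates k s t := by
  refine LogRamification.isCoordinates_of_D_residue_ne_zero
    ((mem_maximalIdeal t).mpr ht.not_isUnit) (fun h => ?_) hs
  rw [ht.maximalIdeal_eq, Ideal.span_singleton_pow, Ideal.mem_span_singleton] at h
  obtain ⟨c, hc⟩ := h
  refine ht.not_isUnit (.of_mul_eq_one c (mul_left_cancel₀ ht.ne_zero ?_))
  rw [mul_one]
  conv_rhs => rw [hc]
  ring

end Cotangent

end LocalAlgebra

/-! ### Two-forms in local coordinates -/

section TwoForms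

set_option linter.unusedSectionVars false

open IsLocalRing TensorProduct KaehlerDifferential

theorem ιMulti_pair {R M : Type*} [CommRing R] [AddCommGroup M] [Module R M] (x y : M)
    (a b c d : R) :
    exteriorPower.ιMulti R 2 ![a • x + b • y, c • x + d • y] =
      (a * d - b * c) • exteriorPower.ιMulti R 2 ![x, y] := by
  let e : M → M → ⋀[R]^2 M := fun x y => exteriorPower.ιMulti R 2 ![x, y]
  have hadd_left : ∀ x x' y, e (x + x') y = e x y + e x' y := fun x x' y =>
    (exteriorPower.ιMulti R 2 (M := M)).map_vecCons_add ![y] x x'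
  have hsmul_left : ∀ (r : R) x y, e (r • x) y = r • e x y := fun r x y =>
    (exteriorPower.ιMulti R 2 (M := M)).map_vecCons_smul ![y] r x
  have hswap : ∀ x y, e x y = - e y x := by
    intro x y
    have := (exteriorPower.ιMulti R 2 (M := M)).map_swap ![y, x] (i := 0) (j := 1) (by decide)
    rw [← this]
    congr 1
  have hself : ∀ x, e x x = 0 := fun x =>
    (exteriorPower.ιMulti R 2 (M := M)).map_eq_zero_of_eq ![x, x] (i := 0) (j := 1) rfl (by decide)
  have hadd_right : ∀ x y y', e x (y + y') = e x y + e x y' := by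
    intro x y y'
    rw [hswap, hadd_left, hswap y, hswap y']
    abel
  have hsmul_right : ∀ (r : R) x y, e x (r • y) = r • e x y := by
    intro r x y
    rw [hswap, hsmul_left, hswap y, smul_neg, neg_neg]
  change e (a • x + b • y) (c • x + d • y) = (a * d - b * c) • e x y
  simp only [hadd_left, hadd_right, hsmul_left, hsmul_right, hself, hswap y x]
  module

/-- The form `ds ∧ dt`. -/
def wedgeD (k : Type*) {K : Type*} [CommRing k] [CommRing K] [Algebra k K] (s t : K) :
    ⋀[K]^2 (Ω[K⁄k]) :=
  exteriorPower.ιMulti K 2 ![D k K s, D k K t]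

theorem wedgeD_of_eq {k K : Type*} [CommRing k] [CommRing K] [Algebra k K] {s t p q : K}
    {a b c d : K} (hp : D k K p = a • D k K s + b • D k K t)
    (hq : D k K q = c • D k K s + d • D k K t) :
    wedgeD k p q = (a * d - b * c) • wedgeD k s t := by
  rw [wedgeD, hp, hq, ιMulti_pair, wedgeD]

namespace IsCoordinates

variable {k A K : Type*} [CommRing k] [CommRing A] [Algebra k A] {s t : A}

/-- The basis `ds, dt` of the module of differentials. -/
def basis (h : IsCoordinates k s t) : Module.Basis (Fin 2) A Ω[A⁄k] :=
  .mk h.1 (by simp [Set.pair_comm (D k A t), h.2])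

theorem coe_basis (h : IsCoordinates k s t) : ⇑h.basis = ![D k A s, D k A t] :=
  Module.Basis.coe_mk _ _

/-- The determinant of the basis `ds, dt`, as a functional on two-forms, takes the value `1` on `ds
∧ dt`. -/
theorem smul_wedgeD_injective (h : IsCoordinates k s t) {a b : A}
    (hab : a • wedgeD k s t = b • wedgeD k s t) : a = b := by
  classical
  have h1 : exteriorPower.alternatingMapLinearEquiv h.basis.det (wedgeD k s t) = 1 := by
    rw [wedgeD, exteriorPower.alternatingMapLinearEquiv_apply_ιMulti, ← h.coe_basis,
      Module.Basis.det_self]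
  have := congr(exteriorPower.alternatingMapLinearEquiv h.basis.det $hab)
  rwa [map_smul, map_smul, h1, smul_eq_mul, smul_eq_mul, mul_one, mul_one] at this

theorem exists_smul_wedgeD (h : IsCoordinates k s t) (ω : ⋀[A]^2 (Ω[A⁄k])) :
    ∃ a : A, ω = a • wedgeD k s t := by
  have hω : ω ∈ Submodule.span A (Set.range (exteriorPower.ιMulti A 2 (M := Ω[A⁄k]))) := by
    rw [exteriorPower.ιMulti_span]; trivial
  induction hω using Submodule.span_induction with
  | mem x hx =>
    obtain ⟨v, rfl⟩ := hx
    have hv : ∀ x : Ω[A⁄k], ∃ a b : A, a • D k A s + b • D k A t = x := fun x =>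
      Submodule.mem_span_pair.mp (h.2 ▸ Submodule.mem_top)
    obtain ⟨a, b, hab⟩ := hv (v 0)
    obtain ⟨c, d, hcd⟩ := hv (v 1)
    refine ⟨a * d - b * c, ?_⟩
    rw [wedgeD, ← ιMulti_pair, hab, hcd]
    congr 1
    ext i
    fin_cases i <;> rfl
  | zero => exact ⟨0, (zero_smul _ _).symm⟩
  | add x y _ _ hx hy =>
    obtain ⟨a, rfl⟩ := hx
    obtain ⟨b, rfl⟩ := hy
    exact ⟨a + b, (add_smul _ _ _).symm⟩
  | smul r x _ hx =>
    obtain ⟨a, rfl⟩ := hx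
    exact ⟨r * a, (mul_smul _ _ _).symm⟩

theorem of_basis (b : Module.Basis (Fin 2) A Ω[A⁄k]) (h0 : b 0 = D k A s) (h1 : b 1 = D k A t) :
    IsCoordinates k s t := by
  have hb : ⇑b = ![D k A s, D k A t] := by
    ext i
    fin_cases i
    · exact h0
    · exact h1
  refine ⟨hb ▸ b.linearIndependent, ?_⟩
  have := b.span_eq
  rw [hb] at this
  simpa [Set.pair_comm (D k A t)] using this

theorem of_field {K : Type*} [Field K] [Algebra k K] (h2 : Module.finrank K Ω[K⁄k] = 2) {s t : K}
    (h : LinearIndependent K ![D k K s, D k K t]) : IsCoordinates k s t :=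
  .of_basis (basisOfLinearIndependentOfCardEqFinrank h (by rw [h2, Fintype.card_fin]))
    (by simp) (by simp)

variable [CommRing K] [Algebra k K] [Algebra A K] [IsScalarTower k A K]

theorem map_localization (h : IsCoordinates k s t) (M : Submonoid A) [IsLocalization M K] :
    IsCoordinates k (algebraMap A K s) (algebraMap A K t) := by
  refine .of_basis (h.basis.ofIsLocalizedModule K M (map k k A K)) ?_ ?_ <;>
  simp [h.coe_basis]

theorem exists_wedgeD_algebraMap_eq (h : IsCoordinates k s t) (p q : A) :
    ∃ J : A, wedgeD k (algebraMap A K p) (algebraMap A K q) =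
      algebraMap A K J • wedgeD k (algebraMap A K s) (algebraMap A K t) := by
  have hv : ∀ x : A, ∃ a b : A, a • D k A s + b • D k A t = D k A x := fun x =>
    Submodule.mem_span_pair.mp (h.2 ▸ Submodule.mem_top)
  have hw : ∀ x : A, ∃ a b : A, D k K (algebraMap A K x) =
      algebraMap A K a • D k K (algebraMap A K s) + algebraMap A K b • D k K (algebraMap A K t) := by
    intro x
    obtain ⟨a, b, hab⟩ := hv x
    refine ⟨a, b, ?_⟩
    simpa [eq_comm] using congr(map k k A K $hab)
  obtain ⟨a, b, hp⟩ := hw p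
  obtain ⟨c, d, hq⟩ := hw q
  refine ⟨a * d - b * c, ?_⟩
  simpa using wedgeD_of_eq hp hq

/-- The Jacobians of the two changes of coordinates are inverse to each other. This makes the
canonical divisor independent of the coordinates. -/
theorem exists_isUnit_wedgeD_eq [IsDomain A] [IsFractionRing A K] {s' t' : A}
    (h : IsCoordinates k s t) (h' : IsCoordinates k s' t') :
    ∃ u : A, IsUnit u ∧ wedgeD k (algebraMap A K s') (algebraMap A K t') =
      algebraMap A K u • wedgeD k (algebraMap A K s) (algebraMap A K t) := by
  obtain ⟨u, hu⟩ := h.exists_wedgeD_algebraMap_eq (K := K) s' t'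
  obtain ⟨v, hv⟩ := h'.exists_wedgeD_algebraMap_eq (K := K) s t
  refine ⟨u, ?_, hu⟩
  have hK := h.map_localization (K := K) (nonZeroDivisors A)
  refine IsUnit.of_mul_eq_one v (IsFractionRing.injective A K (hK.smul_wedgeD_injective ?_))
  rw [map_mul, mul_comm, mul_smul, ← hu, ← hv, map_one, one_smul]

end IsCoordinates

/-! ### Jacobians in coordinates adapted to a curve. -/

section Jacobian

variable {k A K : Type*} [Field k] [CharZero k] [CommRing A] [IsLocalRing A] [Algebra k A]
  [CommRing K] [Algebra k K] [Algebra A K] [IsScalarTower k A K] {σ τ : A}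

/-- By the Leibniz rule only the `dτ` coefficient loses a factor `τ`; the `dσ` coefficient keeps the
full power. Both Jacobian estimates rest on this asymmetry. -/
theorem IsCoordinates.D_unit_mul_pow (h : IsCoordinates k σ τ) (v : A) (n : ℕ) :
    ∃ a b : A, D k A (v * τ ^ (n + 1)) =
      (τ ^ (n + 1) * a) • D k A σ + (τ ^ n * ((n + 1 : ℕ) * v + τ * b)) • D k A τ := by
  obtain ⟨a, b, hab⟩ := Submodule.mem_span_pair.mp
    (show D k A v ∈ Submodule.span A {D k A σ, D k A τ} from h.2 ▸ Submodule.mem_top)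
  refine ⟨a, b, ?_⟩
  rw [Derivation.leibniz, Derivation.leibniz_pow, ← hab, Nat.add_sub_cancel]
  rw [← Nat.cast_smul_eq_nsmul A (n + 1)]
  simp only [smul_add, smul_smul, pow_succ]
  module

/-- The Jacobian of a map with ramification index `n + 1` along the curve `τ = 0`. -/
theorem IsCoordinates.exists_isUnit_wedgeD_unit_mul_pow (h : IsCoordinates k σ τ)
    (hτ : τ ∈ maximalIdeal A) {v : A} (hv : IsUnit v) (n : ℕ) :
    ∃ u : A, IsUnit u ∧ wedgeD k (algebraMap A K σ) (algebraMap A K (v * τ ^ (n + 1))) =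
      algebraMap A K (u * τ ^ n) • wedgeD k (algebraMap A K σ) (algebraMap A K τ) := by
  obtain ⟨a, b, hab⟩ := h.D_unit_mul_pow v n
  refine ⟨(n + 1 : ℕ) * v + τ * b, ?_, ?_⟩
  -- Characteristic zero enters here: `(n + 1) * v` is a unit, and adding a multiple of `τ` does not
  -- change that.
  · have h1 : IsUnit (((n + 1 : ℕ) : A) * v) := (isUnit_natCast k A n.succ_ne_zero).mul hv
    by_contra hn
    exact (mem_maximalIdeal _).mp ((Ideal.add_mem_iff_left _
      (Ideal.mul_mem_right b _ hτ)).mp ((mem_maximalIdeal _).mpr hn)) h1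
  · have hq := congr(map k k A K $hab)
    rw [map_add, map_smul, map_smul, map_D, map_D, map_D, ← algebraMap_smul K,
      ← algebraMap_smul K (τ ^ n * _)] at hq
    rw [wedgeD_of_eq (a := 1) (b := 0) (by simp) hq, one_mul, zero_mul, sub_zero,
      mul_comm (τ ^ n)]

/-- The Jacobian of a map that contracts the curve `τ = 0`. -/
theorem IsCoordinates.exists_wedgeD_unit_mul_pow_mul (h : IsCoordinates k σ τ) (v w : A) (n : ℕ) :
    ∃ c : A, wedgeD k (algebraMap A K (v * τ ^ (n + 1))) (algebraMap A K (w * τ)) =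
      algebraMap A K (c * τ ^ (n + 1)) • wedgeD k (algebraMap A K σ) (algebraMap A K τ) := by
  obtain ⟨a, b, hab⟩ := h.D_unit_mul_pow v n
  obtain ⟨a', b', hab'⟩ := h.D_unit_mul_pow w 0
  rw [zero_add, pow_one] at hab'
  have hp := congr(map k k A K $hab)
  have hq := congr(map k k A K $hab')
  rw [map_add, map_smul, map_smul, map_D, map_D, map_D, ← algebraMap_smul K,
    ← algebraMap_smul K (_ * (_ + _))] at hp hq
  -- Both products in the determinant pair a `dσ` coefficient with a `dτ` coefficient. One is
  -- divisible by `τ ^ (n + 1) * 1`, the other by `τ ^ n * τ`; dividing out `τ ^ (n + 1)` leaves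
  -- this witness.
  refine ⟨a * (w + τ * b') - ((n + 1 : ℕ) * v + τ * b) * a', ?_⟩
  rw [wedgeD_of_eq hp hq, ← map_mul, ← map_mul, ← map_sub]
  congr 2
  push_cast
  ring

end Jacobian

theorem twoFormMap_smul_wedgeD {k A B : Type} [CommRing k] [CommRing A] [CommRing B] [Algebra k A]
    [Algebra k B] [Algebra A B] [IsScalarTower k A B] (a s t : A) :
    twoFormMap k A B (a • wedgeD k s t) =
      algebraMap A B a • wedgeD k (algebraMap A B s) (algebraMap A B t) := by
  rw [map_smul, twoFormMap, wedgeD, exteriorPower.alternatingMapLinearEquiv_apply_ιMulti,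
    algebraMap_smul]
  congr 1
  change exteriorPower.ιMulti B 2 (fun i => map k k A B (![D k A s, D k A t] i)) = _
  rw [wedgeD]
  congr 1
  ext i
  fin_cases i <;> simp

end TwoForms

/-! ### Local rings of smooth surfaces -/

open IsLocalRing KaehlerDifferential

theorem IsSmoothSurfaceAlgebra.of_isLocalization {k B A : Type*} [Field k] [CommRing B] [CommRing A]
    [Nontrivial A] [Algebra k B] [Algebra k A] [Algebra B A] [IsScalarTower k B A]
    [Algebra.IsStandardSmoothOfRelativeDimension 2 k B] (M : Submonoid B) [IsLocalization M A] :
    IsSmoothSurfaceAlgebra k A := by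
  have : Nontrivial B := (algebraMap B A).domain_nontrivial
  have : Algebra.IsStandardSmooth k B :=
    Algebra.IsStandardSmoothOfRelativeDimension.isStandardSmooth 2
  have : Algebra.FormallySmooth B A := .of_isLocalization M
  have : Algebra.EssFiniteType B A := .of_isLocalization _ M
  have hB := Algebra.IsStandardSmoothOfRelativeDimension.rank_kaehlerDifferential (R := k) (S := B) 2
  let b := Module.Free.chooseBasis B Ω[B⁄k]
  refine { toFormallySmooth := .comp k B A, toEssFiniteType := .comp k B A, finrank_kaehler := ?_ }
  rw [Module.finrank_eq_nat_card_basis (b.ofIsLocalizedModule A M (map k k B A)),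
    ← Module.finrank_eq_nat_card_basis b, Module.finrank, hB]
  simp

namespace SmoothProjectiveSurface

variable (X : SmoothProjectiveSurface)

theorem algebraMap_localRing (x : X.scheme) : algebraMap ℂ (X.localRing x) =
    ((Scheme.ΓSpecIso (.of ℂ)).inv ≫ X.str.appTop ≫
      X.scheme.presheaf.germ ⊤ x (TopologicalSpace.Opens.mem_top x)).hom := rfl

theorem stalkSpecializes_algebraMap {x y : X.scheme} (h : x ⤳ y) (c : ℂ) :
    (X.scheme.presheaf.stalkSpecializes h).hom (algebraMap ℂ (X.localRing y) c) =
      algebraMap ℂ (X.localRing x) c := by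
  have : ((Scheme.ΓSpecIso (.of ℂ)).inv ≫ X.str.appTop ≫
      X.scheme.presheaf.germ ⊤ y (TopologicalSpace.Opens.mem_top y)) ≫
      X.scheme.presheaf.stalkSpecializes h = (Scheme.ΓSpecIso (.of ℂ)).inv ≫ X.str.appTop ≫
      X.scheme.presheaf.germ ⊤ x (TopologicalSpace.Opens.mem_top x) := by
    simp only [Category.assoc, TopCat.Presheaf.germ_stalkSpecializes]
  exact congr($(this).hom c)

instance (x : X.scheme) : IsScalarTower ℂ (X.localRing x) X.rationalFunctions :=
  .of_algebraMap_eq fun c =>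
    (X.stalkSpecializes_algebraMap (genericPoint_specializes x) c).symm

instance (x : X.scheme) : IsSmoothSurfaceAlgebra ℂ (X.localRing x) := by
  obtain ⟨U, hU, V, hV, hx, e, hf⟩ :=
    SmoothOfRelativeDimension.exists_isStandardSmoothOfRelativeDimension (n := 2) (f := X.str) x
  -- `Spec ℂ` has a single point, so the chart downstairs is everything.
  obtain rfl : U = ⊤ := by
    have : Subsingleton (Spec (.of ℂ)) :=
      inferInstanceAs (Subsingleton (PrimeSpectrum ℂ))
    rw [eq_top_iff]
    intro y _
    rw [Subsingleton.elim y (X.str x)]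
    exact e hx
  let g : ℂ →+* Γ(X.scheme, V) := (X.str.appLE ⊤ V e).hom.comp
    (Scheme.ΓSpecIso (.of ℂ)).inv.hom
  have hg : g.IsStandardSmoothOfRelativeDimension 2 := by
    have h := hf.comp (RingHom.IsStandardSmoothOfRelativeDimension.equiv
      (Scheme.ΓSpecIso (.of ℂ)).symm.commRingCatIsoToRingEquiv)
    exact h
  algebraize [g]
  let := X.scheme.presheaf.algebra_section_stalk (U := V) ⟨x, hx⟩
  have hloc := hV.isLocalization_stalk ⟨x, hx⟩
  have hres : (Scheme.ΓSpecIso (.of ℂ)).inv ≫ X.str.appLE ⊤ V e ≫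
      X.scheme.presheaf.germ V x hx = (Scheme.ΓSpecIso (.of ℂ)).inv ≫ X.str.appTop ≫
      X.scheme.presheaf.germ ⊤ x (TopologicalSpace.Opens.mem_top x) := by
    rw [Scheme.Hom.appLE, Category.assoc, TopCat.Presheaf.germ_res]
    rfl
  have : IsScalarTower ℂ Γ(X.scheme, V) (X.localRing x) :=
    .of_algebraMap_eq fun c => congr($(hres.symm).hom c)
  exact .of_isLocalization (B := Γ(X.scheme, V)) (hV.primeIdealOf ⟨x, hx⟩).asIdeal.primeCompl

instance : LocallyOfFiniteType X.str :=
  have : Smooth X.str := SmoothOfRelativeDimension.smooth 2 X.str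
  inferInstance

instance : JacobsonSpace X.scheme :=
  LocallyOfFiniteType.jacobsonSpace X.str

theorem fromSpecStalk_str (x : X.scheme) : X.scheme.fromSpecStalk x ≫ X.str =
    Spec.map (CommRingCat.ofHom (algebraMap ℂ (X.localRing x))) := by
  apply ext_of_isAffine
  rw [Scheme.Hom.comp_appTop, Scheme.fromSpecStalk_appTop,
    ← cancel_epi (Scheme.ΓSpecIso (.of ℂ)).inv, ← Scheme.ΓSpecIso_inv_naturality,
    algebraMap_localRing, CommRingCat.ofHom_hom]
  simp only [Category.assoc]
  congr 3

theorem fromSpecResidueField_str (x : X.scheme) : X.scheme.fromSpecResidueField x ≫ X.str =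
    Spec.map (CommRingCat.ofHom (algebraMap ℂ (ResidueField (X.localRing x)))) := by
  rw [Scheme.fromSpecResidueField, Category.assoc, fromSpecStalk_str, ← Spec.map_comp]
  rfl

/-- Without differentials the residue field is unramified and essentially of finite type over `ℂ`,
hence finite, and the point is closed. Conversely, by the Nullstellensatz, the residue field of a
closed point is `ℂ`. -/
theorem subsingleton_kaehler_residueField_iff (x : X.scheme) :
    Subsingleton Ω[ResidueField (X.localRing x)⁄ℂ] ↔ IsClosed {x} := by
  constructor
  · intro h
    have : Algebra.FormallyUnramified ℂ (ResidueField (X.localRing x)) := ⟨h⟩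
    have : Algebra.EssFiniteType ℂ (ResidueField (X.localRing x)) :=
      inferInstanceAs (Algebra.EssFiniteType ℂ (X.localRing x ⧸ maximalIdeal (X.localRing x)))
    have : Module.Finite ℂ (ResidueField (X.localRing x)) :=
      Algebra.FormallyUnramified.finite_of_free _ _
    have : IsFinite (X.scheme.fromSpecResidueField x ≫ X.str) := by
      have h := (IsFinite.SpecMap_iff (f := CommRingCat.ofHom
        (algebraMap ℂ (ResidueField (X.localRing x))))).mpr (RingHom.finite_algebraMap.mpr this)
      rw [fromSpecResidueField_str]
      exact h
    rw [isClosed_singleton_iff_locallyOfFiniteType]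
    exact locallyOfFiniteType_of_comp _ X.str
  · intro h
    apply KaehlerDifferential.subsingleton_of_surjective
    have h1 : (residueFieldIsoBase X.str x h).inv =
        CommRingCat.ofHom (algebraMap ℂ (ResidueField (X.localRing x))) := by
      apply Spec.map_injective
      rw [SpecMap_residueFieldIsoBase_inv, fromSpecResidueField_str]
      rfl
    have h2 := (residueFieldIsoBase X.str x h).symm.commRingCatIsoToRingEquiv.surjective
    intro y
    obtain ⟨c, hc⟩ := h2 y
    exact ⟨c, by rw [← hc]; exact congr($(h1.symm).hom c)⟩

theorem not_isField_of_coheight_eq_one {x : X.scheme} (hx : Order.coheight x = 1) :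
    ¬ IsField (X.localRing x) := by
  intro h
  have h0 := ringKrullDim_eq_zero_of_isField h
  have h1 := ringKrullDim_stalk_eq_coheight x
  rw [hx] at h1
  rw [h1] at h0
  exact one_ne_zero h0

theorem nontrivial_kaehler_of_coheight_eq_one {x : X.scheme} (hx : Order.coheight x = 1) :
    Nontrivial Ω[ResidueField (X.localRing x)⁄ℂ] :=
  have : Ring.KrullDimLE 1 (X.localRing x) := krullDimLE_of_coheight_le hx.le
  nontrivial_kaehler_residueField ℂ (X.localRing x)

theorem isDiscreteValuationRing_of_coheight_eq_one {x : X.scheme} (hx : Order.coheight x = 1) :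
    IsDiscreteValuationRing (X.localRing x) :=
  have := X.nontrivial_kaehler_of_coheight_eq_one hx
  isDiscreteValuationRing_of_nontrivial ℂ _ (X.not_isField_of_coheight_eq_one hx)

theorem coheight_eq_one_of_isDiscreteValuationRing {x : X.scheme}
    [IsDiscreteValuationRing (X.localRing x)] : Order.coheight x = 1 := by
  have h := ringKrullDim_stalk_eq_coheight x
  rw [IsDiscreteValuationRing.ringKrullDim_eq_one] at h
  exact_mod_cast h.symm

end SmoothProjectiveSurface

/-! ### Orders and local equations -/

section Orders

variable {X : SmoothProjectiveSurface}

theorem ordHom_eq {x : X.scheme} (hx : Order.coheight x = 1) [IsDiscreteValuationRing (X.localRing x)]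
    (f : X.rationalFunctions) :
    Scheme.ordHom (X := X.scheme) x hx f = Ring.ordFrac (X.localRing x) f := rfl

theorem algebraMap_rationalFunctions_injective (x : X.scheme) :
    Function.Injective (algebraMap (X.localRing x) X.rationalFunctions) :=
  IsFractionRing.injective _ _

theorem ord_one (x : X.scheme) : Scheme.ord (X := X.scheme) 1 x = 0 := by
  have := Scheme.ord_mul (X := X.scheme) (x := x) (f := 1) (g := 1) one_ne_zero one_ne_zero
  rw [mul_one] at this
  omega

theorem ord_algebraMap_of_isUnit {x : X.scheme} (hx : Order.coheight x = 1) {u : X.localRing x}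
    (hu : IsUnit u) : Scheme.ord (X := X.scheme) (algebraMap _ X.rationalFunctions u) x = 0 := by
  have := X.isDiscreteValuationRing_of_coheight_eq_one hx
  rw [Scheme.ord_eq_iff hx (by
    rw [Ne, map_eq_zero_iff _ (algebraMap_rationalFunctions_injective x)]
    exact hu.ne_zero), ordHom_eq, Ring.ordFrac_of_isUnit hu]
  rfl

theorem ord_algebraMap_of_irreducible {x : X.scheme} (hx : Order.coheight x = 1)
    {τ : X.localRing x} (hτ : Irreducible τ) :
    Scheme.ord (X := X.scheme) (algebraMap _ X.rationalFunctions τ) x = 1 := by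
  have := X.isDiscreteValuationRing_of_coheight_eq_one hx
  rw [Scheme.ord_eq_iff hx (by
    rw [Ne, map_eq_zero_iff _ (algebraMap_rationalFunctions_injective x)]
    exact hτ.ne_zero), ordHom_eq, Ring.ordFrac_irreducible hτ]
  rfl

theorem ord_algebraMap_nonneg {x : X.scheme} (hx : Order.coheight x = 1) {a : X.localRing x}
    (ha : a ≠ 0) : 0 ≤ Scheme.ord (X := X.scheme) (algebraMap _ X.rationalFunctions a) x := by
  have := X.isDiscreteValuationRing_of_coheight_eq_one hx
  rw [Scheme.le_ord_iff hx (by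
    rwa [Ne, map_eq_zero_iff _ (algebraMap_rationalFunctions_injective x)]), ordHom_eq]
  exact Ring.ordFrac_ge_one_of_ne_zero ha

theorem ord_pow {x : X.scheme} {f : X.rationalFunctions} (hf : f ≠ 0) (n : ℕ) :
    Scheme.ord (X := X.scheme) (f ^ n) x = n * Scheme.ord (X := X.scheme) f x := by
  induction n with
  | zero => simp [ord_one]
  | succ n ih =>
    rw [pow_succ, Scheme.ord_mul (pow_ne_zero _ hf) hf, ih]
    push_cast
    ring

namespace LocalEquations

/-- The local equations at each point differ by units. -/
def IsUniqueUpToUnits (E : LocalEquations X) : Prop :=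
  ∀ x, ∀ g ∈ E x, ∀ g' ∈ E x, ∃ u : X.localRing x, IsUnit u ∧
    g' = algebraMap (X.localRing x) X.rationalFunctions u * g

/-- `coeff` is computed from a chosen local equation; units have order zero, so any other local
equation gives the same value. -/
theorem IsUniqueUpToUnits.coeff_eq {E : LocalEquations X} (hE : E.IsUniqueUpToUnits)
    {C : PrimeDivisor X} {g : X.rationalFunctions} (hg : g ∈ E C.point) :
    E.coeff C = Scheme.ord (X := X.scheme) g C.point := by
  have hne : (E C.point).Nonempty := ⟨g, hg⟩
  rw [coeff, dif_pos hne]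
  obtain ⟨u, hu, h⟩ := hE _ _ hg _ hne.some_mem
  rw [h]
  rcases eq_or_ne g 0 with rfl | h0
  · rw [mul_zero]
  · rw [Scheme.ord_mul _ h0, ord_algebraMap_of_isUnit C.coheight_point hu, zero_add]
    rw [Ne, map_eq_zero_iff _ (algebraMap_rationalFunctions_injective _)]
    exact hu.ne_zero

theorem isUniqueUpToUnits_ofReduced (D : ReducedDivisor X) : (ofReduced D).IsUniqueUpToUnits := by
  rintro x _ ⟨h, hh, rfl⟩ _ ⟨h', hh', rfl⟩
  obtain ⟨u, hu⟩ := Ideal.span_singleton_eq_span_singleton.mp (hh.trans hh'.symm)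
  exact ⟨u, u.isUnit, by rw [← hu, map_mul, mul_comm]⟩

theorem isUniqueUpToUnits_canonical (ω : X.RationalTwoForm) :
    (canonical ω).IsUniqueUpToUnits := by
  rintro x a ⟨s, t, h1, h2, ha⟩ a' ⟨s', t', h1', h2', ha'⟩
  have h : IsCoordinates ℂ s t := ⟨h1, h2⟩
  have h' : IsCoordinates ℂ s' t' := ⟨h1', h2'⟩
  obtain ⟨u, hu, he⟩ := h'.exists_isUnit_wedgeD_eq (K := X.rationalFunctions) h
  refine ⟨u, hu, ?_⟩
  have hK := h'.map_localization (K := X.rationalFunctions) (nonZeroDivisors (X.localRing x))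
  apply hK.smul_wedgeD_injective
  refine (ha'.symm.trans ha).trans ?_
  rw [mul_comm, mul_smul, ← he]
  rfl

theorem IsUniqueUpToUnits.add {E F : LocalEquations X} (hE : E.IsUniqueUpToUnits)
    (hF : F.IsUniqueUpToUnits) : (E.add F).IsUniqueUpToUnits := by
  rintro x _ ⟨e, he, f, hf, rfl⟩ _ ⟨e', he', f', hf', rfl⟩
  obtain ⟨u, hu, rfl⟩ := hE x e he e' he'
  obtain ⟨v, hv, rfl⟩ := hF x f hf f' hf'
  exact ⟨u * v, hu.mul hv, by rw [map_mul]; ring⟩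

end LocalEquations

end Orders

/-! ### Components of reduced divisors -/

namespace PrimeDivisor

variable {X : SmoothProjectiveSurface}

/-- A proper specialization strictly raises the codimension. -/
theorem eq_of_specializes {x y : X.scheme} (hx : Order.coheight x = 1) (hy : Order.coheight y = 1)
    (h : x ⤳ y) : x = y := by
  by_contra hne
  have hlt : y < x := lt_of_le_not_ge h fun h' => hne (h.antisymm h').eq
  have := Order.coheight_strictAnti hlt (by rw [hx]; exact ENat.one_lt_top)
  rw [hx, hy] at this
  exact lt_irrefl _ this

theorem mem_curve_iff (C : PrimeDivisor X) (x : X.scheme) : x ∈ C.curve ↔ C.point ⤳ x :=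
  specializes_iff_mem_closure.symm

theorem mem_curve_iff_eq (C C' : PrimeDivisor X) : C'.point ∈ C.curve ↔ C = C' := by
  rw [mem_curve_iff]
  constructor
  · intro h
    exact PrimeDivisor.ext (eq_of_specializes C.coheight_point C'.coheight_point h)
  · rintro rfl
    exact specializes_rfl

theorem idealAt_of_notMem {C : PrimeDivisor X} {x : X.scheme} (h : x ∉ C.curve) :
    C.idealAt x = 1 := by
  rw [mem_curve_iff] at h
  rw [idealAt, dif_neg h, Ideal.one_eq_top]

theorem idealAt_point (C : PrimeDivisor X) :
    C.idealAt C.point = maximalIdeal (X.localRing C.point) := by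
  rw [idealAt, dif_pos specializes_rfl]
  simp only [TopCat.Presheaf.stalkSpecializes_refl]
  rfl

end PrimeDivisor

namespace LocalEquations

variable {X : SmoothProjectiveSurface} {D : ReducedDivisor X}

theorem algebraMap_mem_ofReduced {C : PrimeDivisor X} (hC : C ∈ D) {τ : X.localRing C.point}
    (hτ : maximalIdeal (X.localRing C.point) = Ideal.span {τ}) :
    algebraMap _ X.rationalFunctions τ ∈ ofReduced D C.point := by
  refine ⟨τ, ?_, rfl⟩
  rw [Finset.prod_eq_single C, C.idealAt_point, hτ]
  · intro C' _ hne
    exact PrimeDivisor.idealAt_of_notMem (fun h => hne ((C'.mem_curve_iff_eq C).mp h))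
  · exact fun h => absurd hC h

theorem one_mem_ofReduced {x : X.scheme} (hx : ∀ C ∈ D, x ∉ C.curve) :
    1 ∈ ofReduced D x := by
  refine ⟨1, ?_, (map_one _).symm⟩
  rw [Finset.prod_eq_one fun C hC => PrimeDivisor.idealAt_of_notMem (hx C hC)]
  simp

theorem algebraMap_mem_ofReduced_of_forall {x : X.scheme} {C : PrimeDivisor X} (hC : C ∈ D)
    (hx : ∀ C' ∈ D, C' ≠ C → x ∉ C'.curve) {t : X.localRing x}
    (ht : C.idealAt x = Ideal.span {t}) : algebraMap _ X.rationalFunctions t ∈ ofReduced D x := by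
  refine ⟨t, ?_, rfl⟩
  rw [Finset.prod_eq_single C, ht]
  · exact fun C' hC' hne => PrimeDivisor.idealAt_of_notMem (hx C' hC' hne)
  · exact fun h => absurd hC h

end LocalEquations

/-! ### Dominant morphisms -/

namespace DominantMorphism

variable {W V : SmoothProjectiveSurface} (Φ : DominantMorphism W V)

theorem stalkMap_algebraMap (x : W.scheme) (c : ℂ) :
    (Φ.hom.stalkMap x).hom (algebraMap ℂ (V.localRing (Φ.hom x)) c) =
      algebraMap ℂ (W.localRing x) c := by
  have h : ((Scheme.ΓSpecIso (.of ℂ)).inv ≫ V.str.appTop ≫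
      V.scheme.presheaf.germ ⊤ (Φ.hom x) (TopologicalSpace.Opens.mem_top _)) ≫
      Φ.hom.stalkMap x = (Scheme.ΓSpecIso (.of ℂ)).inv ≫ W.str.appTop ≫
      W.scheme.presheaf.germ ⊤ x (TopologicalSpace.Opens.mem_top _) := by
    simp only [Category.assoc]
    rw [← Φ.comp_str, Scheme.Hom.comp_appTop, Scheme.Hom.germ_stalkMap]
    rfl
  exact congr($(h).hom c)

theorem pullbackFunction_algebraMap (x : W.scheme) (a : V.localRing (Φ.hom x)) :
    Φ.pullbackFunction (algebraMap _ V.rationalFunctions a) =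
      algebraMap _ W.rationalFunctions ((Φ.hom.stalkMap x).hom a) := by
  have h : V.scheme.presheaf.stalkSpecializes (genericPoint_specializes (Φ.hom x)) ≫
      V.scheme.presheaf.stalkSpecializes (specializes_of_eq Φ.map_genericPoint) ≫
      Φ.hom.stalkMap (genericPoint W.scheme) =
      Φ.hom.stalkMap x ≫ W.scheme.presheaf.stalkSpecializes (genericPoint_specializes x) := by
    rw [TopCat.Presheaf.stalkSpecializes_comp_assoc, ← Scheme.Hom.stalkSpecializes_stalkMap]
  exact congr($(h).hom a)

theorem pullbackFunction_injective : Function.Injective Φ.pullbackFunction :=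
  Φ.pullbackFunction.toRingHom.injective

theorem stalkMap_injective (x : W.scheme) : Function.Injective (Φ.hom.stalkMap x).hom := by
  intro a b hab
  apply algebraMap_rationalFunctions_injective
  apply Φ.pullbackFunction_injective
  rw [pullbackFunction_algebraMap, pullbackFunction_algebraMap, hab]

theorem pullbackForm_smul_wedge (a s t : V.rationalFunctions) :
    Φ.pullbackForm (a • V.wedge s t) =
      Φ.pullbackFunction a • W.wedge (Φ.pullbackFunction s) (Φ.pullbackFunction t) := by
  let : Algebra V.rationalFunctions W.rationalFunctions := Φ.pullbackFunction.toRingHom.toAlgebra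
  have : IsScalarTower ℂ V.rationalFunctions W.rationalFunctions :=
    IsScalarTower.of_algHom Φ.pullbackFunction
  exact twoFormMap_smul_wedgeD a s t

/-- In characteristic zero independent differentials stay independent in a field extension, and both
function fields have two-dimensional differentials. This is why the Jacobian of a dominant map is
not zero. -/
theorem isCoordinates_pullbackFunction {s t : V.rationalFunctions} (h : IsCoordinates ℂ s t) :
    IsCoordinates ℂ (Φ.pullbackFunction s) (Φ.pullbackFunction t) := by
  let : Algebra V.rationalFunctions W.rationalFunctions := Φ.pullbackFunction.toRingHom.toAlgebra
  have : IsScalarTower ℂ V.rationalFunctions W.rationalFunctions :=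
    IsScalarTower.of_algHom Φ.pullbackFunction
  have : IsSmoothSurfaceAlgebra ℂ W.rationalFunctions :=
    inferInstanceAs (IsSmoothSurfaceAlgebra ℂ (W.localRing (genericPoint W.scheme)))
  refine .of_field IsSmoothSurfaceAlgebra.finrank_kaehler ?_
  have := linearIndependent_map_of_field (L := W.rationalFunctions) h.1
  convert this using 1
  ext i
  fin_cases i <;> simp <;> rfl

theorem isUniqueUpToUnits_pullbackDivisor {E : LocalEquations V} (hE : E.IsUniqueUpToUnits) :
    (Φ.pullbackDivisor E).IsUniqueUpToUnits := by
  rintro x _ ⟨g, hg, rfl⟩ _ ⟨g', hg', rfl⟩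
  obtain ⟨u, hu, rfl⟩ := hE _ g hg g' hg'
  exact ⟨(Φ.hom.stalkMap x).hom u, hu.map _, by rw [map_mul, pullbackFunction_algebraMap]⟩

/-- The defining equation of `R` with `ω = a ds ∧ dt` inserted: the order of the pullback of `a`
occurs on both sides and cancels, leaving only the Jacobian and the equations of the two boundary
divisors. -/
theorem logRamification_eq {D : ReducedDivisor V} {Δ : ReducedDivisor W} {ω : V.RationalTwoForm}
    (hω : ω ≠ 0) {R : PrimeDivisor W → ℤ} (hR : Φ.IsLogRamificationDivisor D Δ ω R)
    (C : PrimeDivisor W) {s t : V.localRing (Φ.hom C.point)} (hst : IsCoordinates ℂ s t)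
    {σ τ : W.localRing C.point} (hστ : IsCoordinates ℂ σ τ) {J : W.rationalFunctions}
    (hJ : wedgeD ℂ (algebraMap _ W.rationalFunctions ((Φ.hom.stalkMap C.point).hom s))
      (algebraMap _ W.rationalFunctions ((Φ.hom.stalkMap C.point).hom t)) =
      J • wedgeD ℂ (algebraMap _ W.rationalFunctions σ) (algebraMap _ W.rationalFunctions τ))
    {g : W.rationalFunctions} (hg : g ∈ LocalEquations.ofReduced Δ C.point) (hg0 : g ≠ 0)
    {f : V.rationalFunctions} (hf : f ∈ LocalEquations.ofReduced D (Φ.hom C.point))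
    (hf0 : f ≠ 0) :
    J ≠ 0 ∧ Scheme.ord (X := W.scheme) g C.point + Scheme.ord (X := W.scheme) J C.point =
      Scheme.ord (X := W.scheme) (Φ.pullbackFunction f) C.point + R C := by
  have hK := hst.map_localization (K := V.rationalFunctions) (nonZeroDivisors _)
  obtain ⟨a, ha⟩ := hK.exists_smul_wedgeD ω
  have ha0 : a ≠ 0 := by
    rintro rfl
    exact hω (by rw [ha, zero_smul])
  have hpa0 : Φ.pullbackFunction a ≠ 0 := by
    rwa [Ne, map_eq_zero_iff _ Φ.pullbackFunction_injective]
  have hpf0 : Φ.pullbackFunction f ≠ 0 := by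
    rwa [Ne, map_eq_zero_iff _ Φ.pullbackFunction_injective]
  have hJ0 : J ≠ 0 := by
    rintro rfl
    have hW := Φ.isCoordinates_pullbackFunction hK
    rw [pullbackFunction_algebraMap, pullbackFunction_algebraMap] at hW
    have := hW.smul_wedgeD_injective (a := 1) (b := 0) (by rw [hJ, zero_smul, zero_smul, smul_zero])
    exact one_ne_zero this
  refine ⟨hJ0, ?_⟩
  have haV : a ∈ LocalEquations.canonical ω (Φ.hom C.point) := ⟨s, t, hst.1, hst.2, ha⟩
  have haW : Φ.pullbackFunction a * J ∈
      LocalEquations.canonical (Φ.pullbackForm ω) C.point := by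
    refine ⟨σ, τ, hστ.1, hστ.2, ?_⟩
    rw [ha]
    refine (Φ.pullbackForm_smul_wedge a _ _).trans ?_
    rw [pullbackFunction_algebraMap, pullbackFunction_algebraMap, mul_smul]
    exact congrArg _ hJ
  have h1 := hR C
  rw [((LocalEquations.isUniqueUpToUnits_ofReduced Δ).add
      (LocalEquations.isUniqueUpToUnits_canonical _)).coeff_eq ⟨g, hg, _, haW, rfl⟩,
    (Φ.isUniqueUpToUnits_pullbackDivisor ((LocalEquations.isUniqueUpToUnits_ofReduced D).add
      (LocalEquations.isUniqueUpToUnits_canonical _))).coeff_eq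
      ⟨_, ⟨f, hf, _, haV, rfl⟩, rfl⟩, map_mul, Scheme.ord_mul hg0 (mul_ne_zero hpa0 hJ0),
    Scheme.ord_mul hpa0 hJ0, Scheme.ord_mul hpf0 hpa0] at h1
  linarith

end DominantMorphism

/-! ### Local homomorphisms and ramification -/

section LocalHom

set_option linter.unusedSectionVars false

variable {k A B : Type*} [Field k] [CharZero k] [CommRing A] [IsLocalRing A] [Algebra k A]
  [CommRing B] [IsLocalRing B] [Algebra k B]
  [IsSmoothSurfaceAlgebra k B] [Algebra A B] [IsScalarTower k A B] [IsLocalHom (algebraMap A B)]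

variable (k A B) in
theorem isScalarTower_residueField :
    IsScalarTower k (ResidueField A) (ResidueField B) :=
  .of_algebraMap_eq fun c => by
    rw [IsScalarTower.algebraMap_apply k A (ResidueField A),
      IsScalarTower.algebraMap_apply k B (ResidueField B),
      IsScalarTower.algebraMap_apply k A B]
    rfl

theorem linearIndependent_map_residueField {ι : Type*} {v : ι → Ω[ResidueField A⁄k]}
    (hv : LinearIndependent (ResidueField A) v) :
    LinearIndependent (ResidueField B)
      (fun i => map k k (ResidueField A) (ResidueField B) (v i)) := by
  have := isScalarTower_residueField k A B
  have : Algebra.EssFiniteType k (ResidueField B) :=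
    inferInstanceAs (Algebra.EssFiniteType k (B ⧸ maximalIdeal B))
  exact linearIndependent_map_of_field hv

variable (B) in
theorem D_residue_algebraMap_ne_zero {s : A} (hs : D k (ResidueField A) (residue A s) ≠ 0) :
    D k (ResidueField B) (residue B (algebraMap A B s)) ≠ 0 := by
  have h := (linearIndependent_map_residueField (B := B) (v := fun _ : Unit =>
    D k (ResidueField A) (residue A s)) (LinearIndependent.of_subsingleton () hs)).ne_zero ()
  have := isScalarTower_residueField k A B
  rwa [map_D] at h

variable (k A B) in
-- If `A` were a field, its residue field would have two independent differentials. They would stay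
-- independent in the residue field of `B`, where there is room for only one: a curve cannot
-- dominate a surface.
theorem not_isField_of_isLocalHom [IsSmoothSurfaceAlgebra k A] [IsNoetherianRing A]
    [IsNoetherianRing B] (hB : ¬ IsField B) : ¬ IsField A := by
  intro hA
  have h2 := finrank_kaehler_residueField_of_isField k A hA
  have : Module.Finite (ResidueField B) Ω[ResidueField B⁄k] := by
    have : Algebra.EssFiniteType k (ResidueField B) :=
      inferInstanceAs (Algebra.EssFiniteType k (B ⧸ maximalIdeal B))
    infer_instance
  have : Module.Finite (ResidueField A) Ω[ResidueField A⁄k] :=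
    Module.finite_of_finrank_eq_succ h2
  have h := linearIndependent_map_residueField (B := B)
    (Module.finBasisOfFinrankEq _ _ h2).linearIndependent
  have := h.fintype_card_le_finrank.trans (finrank_kaehler_residueField_le_one k B hB)
  simp at this

end LocalHom

/-! ### Coefficients along contracted and noncontracted curves. -/

namespace DominantMorphism

variable {W V : SmoothProjectiveSurface} (Φ : DominantMorphism W V) (C : PrimeDivisor W)

/-- The algebra structure given by the map of local rings. -/
abbrev stalkAlgebra (x : W.scheme) : Algebra (V.localRing (Φ.hom x)) (W.localRing x) :=
  (Φ.hom.stalkMap x).hom.toAlgebra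

theorem isScalarTower_stalkAlgebra (x : W.scheme) :
    letI := Φ.stalkAlgebra x
    IsScalarTower ℂ (V.localRing (Φ.hom x)) (W.localRing x) :=
  letI := Φ.stalkAlgebra x
  .of_algebraMap_eq fun c => (Φ.stalkMap_algebraMap x c).symm

theorem isLocalHom_stalkAlgebra (x : W.scheme) :
    letI := Φ.stalkAlgebra x
    IsLocalHom (algebraMap (V.localRing (Φ.hom x)) (W.localRing x)) :=
  inferInstanceAs (IsLocalHom (Φ.hom.stalkMap x).hom)

/-- The curve contains a closed point, since `W` is a Jacobson space, and a morphism locally of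
finite type sends it to a closed point of `V`. -/
theorem isClosed_of_image_curve_eq {Q : V.scheme} (h : Φ.hom '' C.curve = {Q}) :
    IsClosed {Q} ∧ Φ.hom C.point = Q := by
  have hp : C.point ∈ C.curve := subset_closure rfl
  have hpt : ∀ w ∈ C.curve, Φ.hom w = Q := fun w hw => by
    have : Φ.hom w ∈ Φ.hom '' C.curve := ⟨w, hw, rfl⟩
    rwa [h] at this
  have : LocallyOfFiniteType (Φ.hom ≫ V.str) := by
    rw [Φ.comp_str]
    infer_instance
  have : LocallyOfFiniteType Φ.hom := locallyOfFiniteType_of_comp _ V.str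
  obtain ⟨w, hw, hwc⟩ := nonempty_inter_closedPoints (Z := C.curve) ⟨_, hp⟩
    isClosed_closure.isLocallyClosed
  have hQ : Φ.hom w ∈ closedPoints V.scheme := Φ.hom.closePoints_subset_preimage_closedPoints hwc
  rw [hpt w hw] at hQ
  exact ⟨hQ, hpt _ hp⟩

theorem contracts_of_isClosed (h : IsClosed {Φ.hom C.point}) : Φ.Contracts C := by
  refine ⟨Φ.hom C.point, Set.Subset.antisymm ?_ ?_⟩
  · rw [← h.closure_eq, ← Set.image_singleton]
    exact image_closure_subset_closure_image Φ.hom.continuous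
  · rw [Set.singleton_subset_iff]
    exact ⟨_, subset_closure rfl, rfl⟩

/-- The image of the generic point is not closed, so its residue field has nonzero differentials,
and it is not the generic point of `V`, since a curve cannot dominate. Its local ring is therefore a
discrete valuation ring. -/
theorem coheight_eq_one_of_not_contracts (h : ¬ Φ.Contracts C) :
    Order.coheight (Φ.hom C.point) = 1 := by
  have hcl : ¬ IsClosed {Φ.hom C.point} := fun hcl => h (Φ.contracts_of_isClosed C hcl)
  rw [← V.subsingleton_kaehler_residueField_iff, not_subsingleton_iff_nontrivial] at hcl
  let := Φ.stalkAlgebra C.point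
  have := Φ.isScalarTower_stalkAlgebra C.point
  have := Φ.isLocalHom_stalkAlgebra C.point
  have hA : ¬ IsField (V.localRing (Φ.hom C.point)) :=
    not_isField_of_isLocalHom ℂ _ (W.localRing C.point)
      (W.not_isField_of_coheight_eq_one C.coheight_point)
  have := isDiscreteValuationRing_of_nontrivial ℂ _ hA
  exact V.coheight_eq_one_of_isDiscreteValuationRing

/-- The exponent is positive because the map of stalks is local; it is finite because that map is
injective. -/
theorem exists_stalkMap_eq {τ : W.localRing C.point} (hτ : Irreducible τ)
    {t : V.localRing (Φ.hom C.point)} (ht : t ∈ maximalIdeal _) (ht0 : t ≠ 0) :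
    ∃ (v : W.localRing C.point) (n : ℕ), IsUnit v ∧
      (Φ.hom.stalkMap C.point).hom t = v * τ ^ (n + 1) := by
  have := W.isDiscreteValuationRing_of_coheight_eq_one C.coheight_point
  have h0 : (Φ.hom.stalkMap C.point).hom t ≠ 0 := by
    rwa [Ne, map_eq_zero_iff _ (Φ.stalkMap_injective _)]
  obtain ⟨n, v, hv⟩ := IsDiscreteValuationRing.eq_unit_mul_pow_irreducible h0 hτ
  rcases n with - | n
  · rw [pow_zero, mul_one] at hv
    exact absurd (isUnit_of_map_unit _ t (hv ▸ v.isUnit)) ((mem_maximalIdeal t).mp ht)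
  · exact ⟨v, n, v.isUnit, hv⟩

/-- The coefficient of the logarithmic ramification divisor along a curve that is not
contracted. -/
theorem exists_coefficient_eq {D : ReducedDivisor V} {Δ : ReducedDivisor W}
    {ω : V.RationalTwoForm} (hω : ω ≠ 0) {R : PrimeDivisor W → ℤ}
    (hR : Φ.IsLogRamificationDivisor D Δ ω R) (hP : Order.coheight (Φ.hom C.point) = 1)
    (hmem : C ∈ Δ ↔ (⟨Φ.hom C.point, hP⟩ : PrimeDivisor V) ∈ D) :
    ∃ n : ℕ, (n ≠ 0 → Φ.RamifiesAlong C) ∧ (C ∈ Δ → R C = 0) ∧ (C ∉ Δ → R C = n) := by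
  have := V.isDiscreteValuationRing_of_coheight_eq_one hP
  have := V.nontrivial_kaehler_of_coheight_eq_one hP
  have := W.isDiscreteValuationRing_of_coheight_eq_one C.coheight_point
  obtain ⟨t, ht⟩ := IsDiscreteValuationRing.exists_irreducible (V.localRing (Φ.hom C.point))
  obtain ⟨τ, hτ⟩ := IsDiscreteValuationRing.exists_irreducible (W.localRing C.point)
  obtain ⟨s, hs⟩ := exists_D_residue_ne_zero (k := ℂ) (A := V.localRing (Φ.hom C.point))
  have hst := ht.isCoordinates_of_D_residue_ne_zero hs
  let := Φ.stalkAlgebra C.point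
  have := Φ.isScalarTower_stalkAlgebra C.point
  have := Φ.isLocalHom_stalkAlgebra C.point
  -- The pullback of `s` is itself the first coordinate on `W`, so the Jacobian depends only on the
  -- pullback of `t`.
  have hστ := hτ.isCoordinates_of_D_residue_ne_zero
    (D_residue_algebraMap_ne_zero (W.localRing C.point) hs)
  have htm : maximalIdeal _ = Ideal.span {t} := ht.maximalIdeal_eq
  have hτm : maximalIdeal _ = Ideal.span {τ} := hτ.maximalIdeal_eq
  obtain ⟨v, n, hv, hn⟩ := Φ.exists_stalkMap_eq C hτ ((mem_maximalIdeal t).mpr ht.not_isUnit) ht.ne_zero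
  obtain ⟨u, hu, hJ⟩ := hστ.exists_isUnit_wedgeD_unit_mul_pow (K := W.rationalFunctions)
    ((mem_maximalIdeal τ).mpr hτ.not_isUnit) hv n
  rw [← hn] at hJ
  have hτ0 : algebraMap _ W.rationalFunctions τ ≠ 0 := by
    rw [Ne, map_eq_zero_iff _ (algebraMap_rationalFunctions_injective _)]
    exact hτ.ne_zero
  have hunit : ∀ {u : W.localRing C.point}, IsUnit u →
      algebraMap _ W.rationalFunctions u ≠ 0 := fun hu => by
    rw [Ne, map_eq_zero_iff _ (algebraMap_rationalFunctions_injective _)]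
    exact hu.ne_zero
  have hord : ∀ {u : W.localRing C.point} (m : ℕ), IsUnit u →
      Scheme.ord (X := W.scheme) (algebraMap _ W.rationalFunctions (u * τ ^ m)) C.point = m := by
    intro u m hu
    rw [map_mul, map_pow, Scheme.ord_mul (hunit hu) (pow_ne_zero _ hτ0), ord_pow hτ0,
      ord_algebraMap_of_irreducible C.coheight_point hτ,
      ord_algebraMap_of_isUnit C.coheight_point hu]
    ring
  refine ⟨n, fun hn0 => ⟨hP, ?_⟩, fun hC => ?_, fun hC => ?_⟩
  · rw [htm, Ideal.map_span, Set.image_singleton, hn, Ideal.span_singleton_le_iff_mem]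
    refine Ideal.mul_mem_left _ _ (Ideal.pow_le_pow_right (by omega : 2 ≤ n + 1)
      (Ideal.pow_mem_pow ((mem_maximalIdeal τ).mpr hτ.not_isUnit) _))
  -- Both boundary equations are uniformizers: `1 + n = (n + 1) + R C`.
  · have h := (Φ.logRamification_eq hω hR C hst hστ hJ
      (LocalEquations.algebraMap_mem_ofReduced hC hτm) hτ0
      (LocalEquations.algebraMap_mem_ofReduced (hmem.mp hC) htm) (by
        rw [Ne, map_eq_zero_iff _ (algebraMap_rationalFunctions_injective _)]
        exact ht.ne_zero)).2
    rw [pullbackFunction_algebraMap, hn, hord _ hv, hord _ hu,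
      ord_algebraMap_of_irreducible C.coheight_point hτ] at h
    push_cast at h
    linarith
  -- Both boundary equations are `1`: `n = R C`.
  · have h := (Φ.logRamification_eq hω hR C hst hστ hJ
      (LocalEquations.one_mem_ofReduced fun C' hC' h => hC ((C'.mem_curve_iff_eq C).mp h ▸ hC'))
      one_ne_zero
      (LocalEquations.one_mem_ofReduced fun D' hD' h => hC (hmem.mpr
        ((D'.mem_curve_iff_eq ⟨Φ.hom C.point, hP⟩).mp h ▸ hD'))) one_ne_zero).2
    rw [map_one, ord_one, hord _ hu] at h
    linarith

/-- A noncontracted component of `Δ` must lie over `D`, so its image, being of codimension one, is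
the generic point of a component. Conversely, a curve over a component of `D` lies in the support of
`Δ`, and is a component for the same reason of codimension. -/
theorem mem_iff_of_not_contracts {D : ReducedDivisor V} {Δ : ReducedDivisor W}
    (hpre : Φ.hom ⁻¹' D.support ⊆ Δ.support)
    (hcontr : ∀ C ∈ Δ, ¬ C.curve ⊆ Φ.hom ⁻¹' D.support → Φ.Contracts C)
    (h : ¬ Φ.Contracts C) (hP : Order.coheight (Φ.hom C.point) = 1) :
    C ∈ Δ ↔ (⟨Φ.hom C.point, hP⟩ : PrimeDivisor V) ∈ D := by
  constructor
  · intro hC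
    have hsub := by_contra fun hn => h (hcontr C hC hn)
    have hp : Φ.hom C.point ∈ D.support := hsub (subset_closure rfl)
    simp only [ReducedDivisor.support, Set.mem_iUnion] at hp
    obtain ⟨D', hD', hm⟩ := hp
    rwa [← (D'.mem_curve_iff_eq ⟨Φ.hom C.point, hP⟩).mp hm]
  · intro hD
    have hp : C.point ∈ Δ.support := hpre <| by
      simp only [ReducedDivisor.support, Set.mem_preimage, Set.mem_iUnion]
      exact ⟨_, hD, subset_closure rfl⟩
    simp only [ReducedDivisor.support, Set.mem_iUnion] at hp
    obtain ⟨C', hC', hm⟩ := hp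
    rwa [← (C'.mem_curve_iff_eq C).mp hm]

/-- At a closed point that lies on at most one component of a divisor with simple normal crossings
there are local coordinates such that the divisor is given by `1` or by the first coordinate. -/
theorem _root_.LogRamification.ReducedDivisor.IsSNC.exists_localEquation
    {X : SmoothProjectiveSurface} {D : ReducedDivisor X}
    (hD : D.IsSNC) {x : X.scheme} (hx : IsClosed {x})
    (h : ∀ D₁ ∈ D, ∀ D₂ ∈ D, x ∈ D₁.curve → x ∈ D₂.curve → D₁ = D₂) :
    ∃ t u : X.localRing x, Ideal.span {t, u} = maximalIdeal (X.localRing x) ∧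
      (1 ∈ LocalEquations.ofReduced D x ∨
        algebraMap _ X.rationalFunctions t ∈ LocalEquations.ofReduced D x) := by
  obtain ⟨t, u, htu, hC⟩ := hD x hx
  by_cases hn : ∀ C ∈ D, x ∉ C.curve
  · exact ⟨t, u, htu, .inl (LocalEquations.one_mem_ofReduced hn)⟩
  push Not at hn
  obtain ⟨C, hCD, hxC⟩ := hn
  have huniq : ∀ C' ∈ D, C' ≠ C → x ∉ C'.curve := fun C' hC' hne hx' =>
    hne (h C' hC' C hCD hx' hxC)
  rcases hC C hCD hxC with h1 | h1
  · exact ⟨t, u, htu, .inr (LocalEquations.algebraMap_mem_ofReduced_of_forall hCD huniq h1)⟩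
  · exact ⟨u, t, by rwa [Set.pair_comm],
      .inr (LocalEquations.algebraMap_mem_ofReduced_of_forall hCD huniq h1)⟩

/-- A contracted component of `Δ` has positive coefficient if it is not mapped to an intersection
point of two components of `D`. -/
theorem coefficient_pos_of_isClosed {D : ReducedDivisor V} (hD : D.IsSNC) {Δ : ReducedDivisor W}
    {ω : V.RationalTwoForm} (hω : ω ≠ 0) {R : PrimeDivisor W → ℤ}
    (hR : Φ.IsLogRamificationDivisor D Δ ω R) (hC : C ∈ Δ) (hcl : IsClosed {Φ.hom C.point})
    (h : ∀ D₁ ∈ D, ∀ D₂ ∈ D, Φ.hom C.point ∈ D₁.curve → Φ.hom C.point ∈ D₂.curve → D₁ = D₂) :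
    0 < R C := by
  have := W.isDiscreteValuationRing_of_coheight_eq_one C.coheight_point
  have := W.nontrivial_kaehler_of_coheight_eq_one C.coheight_point
  obtain ⟨τ, hτ⟩ := IsDiscreteValuationRing.exists_irreducible (W.localRing C.point)
  obtain ⟨σ, hσ⟩ := exists_D_residue_ne_zero (k := ℂ) (A := W.localRing C.point)
  have hστ := hτ.isCoordinates_of_D_residue_ne_zero hσ
  obtain ⟨t, u, htu, hf⟩ := hD.exists_localEquation hcl h
  have hcoord : IsCoordinates ℂ t u := isCoordinates_of_span_eq_maximalIdeal
    ((V.subsingleton_kaehler_residueField_iff _).mpr hcl) htu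
  have htm : t ∈ maximalIdeal _ := htu ▸ Ideal.subset_span (by simp)
  have hum : u ∈ maximalIdeal _ := htu ▸ Ideal.subset_span (by simp)
  have ht0 : t ≠ 0 := by
    rintro rfl
    exact hcoord.1.ne_zero 0 (by simp)
  have hu0 : u ≠ 0 := by
    rintro rfl
    exact hcoord.1.ne_zero 1 (by simp)
  obtain ⟨v, n, hv, hn⟩ := Φ.exists_stalkMap_eq C hτ htm ht0
  obtain ⟨w, m, -, hm⟩ := Φ.exists_stalkMap_eq C hτ hum hu0
  -- One factor `τ` is split off the pullback of `u`; the estimate then uses the whole order `n + 1`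
  -- of `t` and only the vanishing of `u`.
  obtain ⟨c, hJ⟩ := hστ.exists_wedgeD_unit_mul_pow_mul (K := W.rationalFunctions) v (w * τ ^ m) n
  rw [mul_assoc w, ← pow_succ, ← hn, ← hm] at hJ
  have hinj := algebraMap_rationalFunctions_injective C.point
  have hτ0 : algebraMap _ W.rationalFunctions τ ≠ 0 := by
    rw [Ne, map_eq_zero_iff _ hinj]
    exact hτ.ne_zero
  have hord : ∀ {a : W.localRing C.point} (m : ℕ), a ≠ 0 →
      Scheme.ord (X := W.scheme) (algebraMap _ W.rationalFunctions (a * τ ^ m)) C.point =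
        Scheme.ord (X := W.scheme) (algebraMap _ W.rationalFunctions a) C.point + m := by
    intro a m ha
    rw [map_mul, map_pow, Scheme.ord_mul ((map_ne_zero_iff _ hinj).mpr ha) (pow_ne_zero _ hτ0),
      ord_pow hτ0, ord_algebraMap_of_irreducible C.coheight_point hτ, mul_one]
  have key := fun {f} hf hf0 => Φ.logRamification_eq hω hR C hcoord hστ hJ
      (LocalEquations.algebraMap_mem_ofReduced hC hτ.maximalIdeal_eq) hτ0 (f := f) hf hf0
  have hc : algebraMap _ W.rationalFunctions (c * τ ^ (n + 1)) ≠ 0 → c ≠ 0 := by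
    rintro h rfl
    exact h (by rw [zero_mul, map_zero])
  -- With `f = 1` the equation gives `R C = ord c + n + 2`; with `f = t` the two terms `n + 1`
  -- cancel and `R C = ord c + 1`. Here `ord c ≥ 0`.
  rcases hf with hf | hf
  · obtain ⟨hJ0, hk⟩ := key hf one_ne_zero
    have hnn := ord_algebraMap_nonneg C.coheight_point (hc hJ0)
    rw [map_one, ord_one, hord _ (hc hJ0),
      ord_algebraMap_of_irreducible C.coheight_point hτ] at hk
    push_cast at hk
    linarith
  · obtain ⟨hJ0, hk⟩ := key hf ((map_ne_zero_iff _
      (algebraMap_rationalFunctions_injective _)).mpr ht0)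
    have hnn := ord_algebraMap_nonneg C.coheight_point (hc hJ0)
    rw [pullbackFunction_algebraMap, hn, hord _ hv.ne_zero, hord _ (hc hJ0),
      ord_algebraMap_of_irreducible C.coheight_point hτ,
      ord_algebraMap_of_isUnit C.coheight_point hv] at hk
    linarith

end DominantMorphism

end LogRamification

end

/-! ### The theorem. -/

open LogRamification in
theorem lemma3p4 (W V : SmoothProjectiveSurface) (D : ReducedDivisor V) (Δ : ReducedDivisor W)
    (hD : D.IsSNC) (hΔ : Δ.IsSNC) (Φ : DominantMorphism W V)
    (hpre : Φ.hom ⁻¹' D.support ⊆ Δ.support)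
    (hcontr : ∀ C ∈ Δ, ¬ C.curve ⊆ Φ.hom ⁻¹' D.support → Φ.Contracts C)
    (ω : V.RationalTwoForm) (hω : ω ≠ 0)
    (R : PrimeDivisor W → ℤ) (hR : Φ.IsLogRamificationDivisor D Δ ω R) :
    (∀ C : PrimeDivisor W, R C ≠ 0 → Φ.Contracts C ∨ Φ.RamifiesAlong C) ∧
    (∀ C ∈ Δ, ¬ Φ.Contracts C → R C = 0) ∧
    (∀ C ∈ Δ, R C = 0 → ∀ Q : V.scheme, Φ.hom '' C.curve = {Q} →
      ∃ D₁ ∈ D, ∃ D₂ ∈ D, D₁ ≠ D₂ ∧ Q ∈ D₁.curve ∩ D₂.curve) := by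
  have key : ∀ C, ¬ Φ.Contracts C →
      ∃ n : ℕ, (n ≠ 0 → Φ.RamifiesAlong C) ∧ (C ∈ Δ → R C = 0) ∧ (C ∉ Δ → R C = n) := fun C h =>
    have hP := Φ.coheight_eq_one_of_not_contracts C h
    Φ.exists_coefficient_eq C hω hR hP (Φ.mem_iff_of_not_contracts C hpre hcontr h hP)
  refine ⟨fun C hRC => ?_, fun C hC h => ?_, fun C hC hRC Q hQ => ?_⟩
  · refine or_iff_not_imp_left.mpr fun h => ?_
    obtain ⟨n, hram, hmem, hnot⟩ := key C h
    have hC : C ∉ Δ := fun hC => hRC (hmem hC)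
    refine hram fun hn => hRC ?_
    rw [hnot hC, hn, Nat.cast_zero]
  · obtain ⟨n, -, hmem, -⟩ := key C h
    exact hmem hC
  · obtain ⟨hcl, rfl⟩ := Φ.isClosed_of_image_curve_eq C hQ
    by_contra hn
    refine (Φ.coefficient_pos_of_isClosed C hD hω hR hC hcl ?_).ne' hRC
    intro D₁ hD₁ D₂ hD₂ h₁ h₂
    by_contra hne
    exact hn ⟨D₁, hD₁, D₂, hD₂, hne, h₁, h₂⟩
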